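/- Let $Q\subset\mathbb R^3$ be open, $T^*Q=Q\times\mathbb R^3$ with coordinates $z=(q,p)$, symplectic form $\Omega=dp\wedge dq$ and Liouville measure $d\mu=d^3q\,d^3p$. A vector field $X$ is Hamiltonian with Hamiltonian function $h$ if $i_X\Omega=-dh$. Let $\mathcal F(Q)=C^\infty(Q)$ (an additive group, the gauge group), let $\mathfrak g$ be the Lie algebra of smooth globally Hamiltonian vector fields on $T^*Q$ with minus the Jacobi–Lie bracket, and let $\mathrm{ver}(d\phi)=\nabla_q\phi\cdot\nabla_p$ be the vertical lift of $d\phi$. A function $g$ on $T^*Q$ is called fibre-dominated if for each compact $K\subset Q$ there is $b\in L^1(\mathbb R^3)$ with $|g(q,p)|\le b(p)$ for $q\in K$. Let $\mathfrak g^*$ be the set of smooth one-forms (one-form densities $\Pi\otimes d\mu$) $\Pi=\Pi_q\cdot dq+\Pi_p\cdot dp$ on $T^*Q$ that are fibre-dominated together with their first derivatives and whose density $f_\Pi:=\operatorname{div}\Pi^\sharp=\nabla_p\cdot\Pi_q-\nabla_q\cdot\Pi_p$ is not constant; let $Den(T^*Q)$ be the set of $f\,d\mu$ with $f$ smooth and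 fibre-dominated. Pairings: $\langle\beta,\alpha\rangle=\int_Q\alpha\wedge\beta$ for a two-form $\beta$ and a one-form $\alpha$ on $Q$, $\langle\Pi,X\rangle=\int_{T^*Q}\Pi(X)\,d\mu$, $\langle f\,d\mu,k\rangle=\int_{T^*Q}fk\,d\mu$. $*$ is the Euclidean Hodge star, densities on $Q$ are continuous three-forms, and they are paired with $\psi\in C_c^\infty(Q)$ by integration. (1) For $\phi\in\mathcal F(Q)$ put $\tau_\phi(q,p)=(q,p-\nabla_q\phi(q))$. This is an action of $\mathcal F(Q)$ on $T^*Q$ by smooth symplectic maps; its generator is $\mathrm{ver}(-d\phi)$, which is Hamiltonian with Hamiltonian function $\phi$. (2) $\mathrm{ver}\circ d:\mathcal F(Q)\to\mathfrak g$ is linear, $\mathrm{ver}(d\phi)$ has the Hamiltonian function $-\phi$, the images commute, $\mathrm{ver}$ is injective on $d\mathcal F(Q)$ (so for connected $Q$ the kernel of $\mathrm{ver}\circ d$ is the constants), and its image is exactly the set of vertical fields in $\mathfrak g$. (3) For $\phi\in\mathcal F(Q)$, $\Pi\in\mathfrak g^*$ and $\psi\in C_c^\infty(Q)$ all the pairings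 used here converge, $d{*}d\phi=\nabla^2\phi\,d^3q$, $\langle *d\phi,d\psi\rangle=-\int_Q\psi\,d{*}d\phi$, and $\langle\Pi,\mathrm{ver}(d\psi)\rangle=-\int_{T^*Q}\psi(q)\,\nabla_q\cdot\Pi_p(z)\,d\mu(z)$. (4) Let $\mathbb J_{\mathcal P}:*d\mathcal F(Q)\times\mathfrak g^*\to Den(Q)$ be the dual of $\psi\mapsto(-d\psi,\mathrm{ver}(d\psi))$, that is, $\int_Q\psi\,\mathbb J_{\mathcal P}(*d\phi,\Pi)=-\langle *d\phi,d\psi\rangle+\langle\Pi,\mathrm{ver}(d\psi)\rangle$ for all $\psi\in C_c^\infty(Q)$. Then there is exactly one such density, namely $$\mathbb J_{\mathcal P}(*d\phi,\Pi)=\Bigl(\nabla_q^2\phi(q)-\int\nabla_q\cdot\Pi_p(z)\,d^3p\Bigr)d^3q,$$ and it vanishes if and only if $\nabla_q^2\phi=\int\nabla_q\cdot\Pi_p\,d^3p$ on $Q$. More generally, for $e\in\mathbb R$, the value at $(*d\phi,e\Pi)$ (defined by the same duality) is zero if and only if $\nabla^2_q\phi=e\int\nabla_q\cdot\Pi_p\,d^3p$,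 and if and only if $\nabla^2_q\phi=-e\int f_\Pi\,d^3p$; moreover $f_\Pi\,d\mu\in Den(T^*Q)$. $\mathbb J_{\mathcal P}$ is a momentum map: for $\psi,\chi\in C_c^\infty(Q)$ and compactly supported $X\in\mathfrak g$, the derivative at $s=0$ of the functional $\langle *d\phi,d\chi\rangle+\langle\cdot,X\rangle$ along $s\mapsto(*d\phi,\tau_{s\psi}^*\Pi)$ is its $+$Lie–Poisson bracket with the $\psi$-component of $\mathbb J_{\mathcal P}$, namely $-\langle\Pi,[X,\mathrm{ver}(d\psi)]\rangle$ with $[\,,]$ the Jacobi–Lie bracket (the factor $d\mathcal F(Q)$ is abelian and does not contribute). (5) Analogously, for $e\in\mathbb R$ and $f\,d\mu\in Den(T^*Q)$, the dual $\mathbb J_{\mathcal P}:*d\mathcal F(Q)\times Den(T^*Q)\to Den(Q)$ of $\psi\mapsto(d\psi,-\psi)$ is given by $$\mathbb J_{\mathcal P}(*d\phi,ef\,d\mu)=-\Bigl(\nabla_q^2\phi(q)+e\int f(z)\,d^3p\Bigr)d^3q,$$ and it vanishes if and only if $\nabla_q^2\phi=-e\int f\,d^3p$ on $Q$. The derivative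 at $s=0$ of $\langle *d\phi,d\chi\rangle+\langle f\circ\tau_{s\psi}\,d\mu,k\rangle$, for $k\in C_c^\infty(T^*Q)$, is the Lie–Poisson bracket $\int_{T^*Q}f\{k,-\psi\}\,d\mu$, where $\{k,h\}=\nabla_qk\cdot\nabla_ph-\nabla_pk\cdot\nabla_qh$. (6) Let $m>0$, $e\in\mathbb R$, $I\subset\mathbb R$ open, $\phi_t\in\mathcal F(Q)$ for $t\in I$, and let $X_h=\frac pm\cdot\nabla_q-e\nabla_q\phi_t\cdot\nabla_p$ be the Hamiltonian vector field of $h=\frac{p^2}{2m}+e\phi_t(q)$. For a curve $\Pi_t$ in $\mathfrak g^*$, the momentum-Vlasov equations $$\dot\Pi_q=-X_h(\Pi_q)+e(\Pi_p\cdot\nabla_q)\nabla_q\phi_t,\qquad \dot\Pi_p=-X_h(\Pi_p)-\tfrac1m\Pi_q$$ together with the Poisson equation $\nabla_q^2\phi_t=-e\int f_{\Pi_t}\,d^3p$ hold on $I$ if and only if the momentum-Vlasov equations hold and $\mathbb J_{\mathcal P}(*d\phi_t,e\Pi_t)=0$ for all $t\in I$. If these hold and $\Pi$ is jointly smooth in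 $(t,z)$, then $f_{\Pi_t}$ solves the Vlasov equation $\partial_tf+\frac pm\cdot\nabla_qf-e\nabla_q\phi_t\cdot\nabla_pf=0$ and $\mathbb J_{\mathcal P}(*d\phi_t,ef_{\Pi_t}d\mu)=0$ for all $t\in I$. Similarly, for a curve $f_t\,d\mu$ in $Den(T^*Q)$, the Vlasov equation together with $\nabla_q^2\phi_t=-e\int f_t\,d^3p$ hold on $I$ if and only if the Vlasov equation holds and $\mathbb J_{\mathcal P}(*d\phi_t,ef_t\,d\mu)=0$ for all $t\in I$. -/

import Mathlib

open scoped ContDiff Gradient Laplacian RealInnerProductSpace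
open MeasureTheory Set

noncomputable section

namespace PoissonVlasov

/-! ### Configuration space, phase space, forms -/

/-- Euclidean three-space; the configuration space is an open subset `Q` of it. -/
abbrev E3 : Type := EuclideanSpace ℝ (Fin 3)

/-- Coordinates `z = (q, p)` on the phase space (and on its tangent spaces). The measure `volume` on
it is the Liouville measure `d³q d³p`. -/
abbrev Ph : Type := E3 × E3

/-- One-forms, two-forms and three-forms on (open subsets of) `E3`. -/
abbrev Form1 : Type := E3 → E3 →L[ℝ] ℝ
abbrev Form2 : Type := E3 → E3 [⋀^Fin 2]→L[ℝ] ℝ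
abbrev Form3 : Type := E3 → E3 [⋀^Fin 3]→L[ℝ] ℝ

/-- One-forms `Π` on phase space. The one-form density `Π ⊗ dμ` is represented by `Π`, since the
Liouville volume `dμ` is fixed. -/
abbrev PhForm : Type := Ph → Ph →L[ℝ] ℝ

/-- The cotangent bundle `T*Q = Q × ℝ³`. -/
def phase (Q : Set E3) : Set Ph := Q ×ˢ (univ : Set E3)

/-- `F(Q)`: smooth functions on `Q`. -/
def IsFun (Q : Set E3) (φ : E3 → ℝ) : Prop := ContDiffOn ℝ ∞ φ Q

/-- Elements of `F(Q)` with compact support in `Q`, the test functions of the duality between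
`F(Q)` and the densities on `Q`. -/
def IsTest (Q : Set E3) (ψ : E3 → ℝ) : Prop :=
  ContDiff ℝ ∞ ψ ∧ HasCompactSupport ψ ∧ tsupport ψ ⊆ Q

/-- The differential of a function. -/
def dd (φ : E3 → ℝ) : Form1 := fun q => fderiv ℝ φ q

/-- The standard basis vectors `e₁, e₂, e₃`. -/
def stdE (i : Fin 3) : E3 := EuclideanSpace.single i 1

/-- The Euclidean volume form `d³q = dq¹ ∧ dq² ∧ dq³` (the determinant). -/
def vol3 : E3 [⋀^Fin 3]→L[ℝ] ℝ :=
  { (Matrix.detRowAlternating (n := Fin 3) (R := ℝ)).compLinearMap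
      (EuclideanSpace.equiv (Fin 3) ℝ).toLinearMap with
    cont := by
      change Continuous fun v : Fin 3 → E3 => Matrix.det fun i j => v i j
      refine Continuous.matrix_det ?_
      fun_prop }

/-- The Euclidean Hodge star of a one-form: `(*α)(u, v) = d³q(α♯, u, v)`. -/
def star1 (α : Form1) : Form2 :=
  fun q => vol3.curryLeft ((InnerProductSpace.toDual ℝ E3).symm (α q))

/-- The wedge product of a one-form and a two-form:
`(α ∧ β)(u, v, w) = α(u) β(v, w) - α(v) β(u, w) + α(w) β(u, v)`. -/
def wedge12 (α : Form1) (β : Form2) : Form3 :=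
  fun q => ContinuousAlternatingMap.alternatizeUncurryFin ((α q).smulRight (β q))

/-- The integral over `Q` of a three-form multiplied by a function. -/
def integ3 (Q : Set E3) (ψ : E3 → ℝ) (η : Form3) : ℝ := ∫ q in Q, ψ q * η q stdE

/-- The pairing `⟨β, α⟩ = ∫_Q α ∧ β` of two-forms with one-forms. -/
def pairQ (Q : Set E3) (β : Form2) (α : Form1) : ℝ := ∫ q in Q, wedge12 α β q stdE

/-! ### Symplectic geometry of `T*Q` and the gauge action -/

/-- The canonical symplectic form `dp ∧ dq`. -/
def symp (u v : Ph) : ℝ := ⟪u.2, v.1⟫ - ⟪u.1, v.2⟫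

/-- `X` is Hamiltonian on `T*Q` with Hamiltonian function `h`: `i_X (dp ∧ dq) = -dh`. -/
def IsHamiltonianFor (Q : Set E3) (X : Ph → Ph) (h : Ph → ℝ) : Prop :=
  ∀ z ∈ phase Q, ∀ v, symp (X z) v = -(fderiv ℝ h z v)

/-- The Lie algebra `𝔤` of (globally) Hamiltonian smooth vector fields on `T*Q`. -/
def IsHamField (Q : Set E3) (X : Ph → Ph) : Prop :=
  ContDiffOn ℝ ∞ X (phase Q) ∧
    ∃ h : Ph → ℝ, ContDiffOn ℝ ∞ h (phase Q) ∧ IsHamiltonianFor Q X h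

/-- The fibre translation `(q, p) ↦ (q, p - ∇φ(q))`. -/
def fibreShift (φ : E3 → ℝ) (z : Ph) : Ph := (z.1, z.2 - ∇ φ z.1)

/-- The vertical lift of a one-form on `Q`: for `α = dφ` it is `∇φ(q) · ∇_p`. -/
def ver (α : Form1) (z : Ph) : Ph := (0, (InnerProductSpace.toDual ℝ E3).symm (α z.1))

/-- The components of `Π = Π_q · dq + Π_p · dp`. -/
def momQ (P : PhForm) (z : Ph) : E3 :=
  (InnerProductSpace.toDual ℝ E3).symm ((P z).comp (ContinuousLinearMap.inl ℝ E3 E3))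

def momP (P : PhForm) (z : Ph) : E3 :=
  (InnerProductSpace.toDual ℝ E3).symm ((P z).comp (ContinuousLinearMap.inr ℝ E3 E3))

/-- The gauge action on one-forms: pull-back by the fibre translation. -/
def gaugePull (φ : E3 → ℝ) (P : PhForm) : PhForm :=
  fun z => (P (fibreShift φ z)).comp (fderiv ℝ (fibreShift φ) z)

/-- The symplectic dual `Π♯ = (-Π_p, Π_q)`. -/
def sharp (P : PhForm) (z : Ph) : Ph := (-momP P z, momQ P z)

/-- The divergences `∇_q · Y` and `∇_p · Y` of an `ℝ³`-valued function on phase space. -/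
def divQ (Y : Ph → E3) (z : Ph) : ℝ := ∑ i, fderiv ℝ Y z (stdE i, 0) i

def divP (Y : Ph → E3) (z : Ph) : ℝ := ∑ i, fderiv ℝ Y z (0, stdE i) i

/-- The divergence, for the Liouville volume, of a vector field on phase space. -/
def phaseDiv (X : Ph → Ph) (z : Ph) : ℝ :=
  divQ (fun y => (X y).1) z + divP (fun y => (X y).2) z

/-- The plasma density `f = div Π♯ = ∇_p · Π_q - ∇_q · Π_p`. -/
def density (P : PhForm) (z : Ph) : ℝ := phaseDiv (sharp P) z

/-! ### The dual spaces -/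

/-- Decay in the momentum variable, locally uniformly in `q ∈ Q`: domination by an integrable
function of `p`. -/
def FibreDominated {F : Type} [NormedAddCommGroup F] (Q : Set E3) (g : Ph → F) : Prop :=
  ∀ K ⊆ Q, IsCompact K →
    ∃ b : E3 → ℝ, Integrable b ∧ ∀ q ∈ K, ∀ p, ‖g (q, p)‖ ≤ b p

/-- The dual `𝔤*`: smooth one-forms (one-form densities) on `T*Q` for which `div Π♯` is not a
constant, and which decay with their first derivatives in the momentum variable, so that the
`L²`-pairings and the momentum integrals converge. -/
def IsDualForm (Q : Set E3) (P : PhForm) : Prop :=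
  ContDiffOn ℝ ∞ P (phase Q) ∧ FibreDominated Q P ∧ FibreDominated Q (fderiv ℝ P) ∧
    ¬ ∃ c : ℝ, ∀ z ∈ phase Q, density P z = c

/-- `Den(T*Q)`: the densities `f dμ` with `f` smooth and decaying in the momentum variable. -/
def IsDensity (Q : Set E3) (f : Ph → ℝ) : Prop :=
  ContDiffOn ℝ ∞ f (phase Q) ∧ FibreDominated Q f

/-- The pairing `⟨Π, X⟩ = ∫_{T*Q} Π(X) dμ`. -/
def pairT (Q : Set E3) (P : PhForm) (X : Ph → Ph) : ℝ := ∫ z in phase Q, P z (X z)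

/-- The pairing `⟨f dμ, k⟩ = ∫_{T*Q} f k dμ`. -/
def pairD (Q : Set E3) (f k : Ph → ℝ) : ℝ := ∫ z in phase Q, f z * k z

/-! ### The momentum maps -/

/-- `η` is the density (three-form) `J_P(β, Π)` on `Q`, where `J_P` is the dual of the map
`ψ ↦ (-dψ, ver(dψ))` from `F(Q)` into `dF(Q) × 𝔤`. -/
def IsJP (Q : Set E3) (β : Form2) (P : PhForm) (η : Form3) : Prop :=
  ContinuousOn η Q ∧
    ∀ ψ, IsTest Q ψ → integ3 Q ψ η = pairQ Q β (-dd ψ) + pairT Q P (ver (dd ψ))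

/-- `η` is the density (three-form) `J_P(β, f dμ)` on `Q`, where `J_P` is the dual of the map
`ψ ↦ (dψ, -ψ)` from `F(Q)` into `dF(Q) × F(T*Q)`. -/
def IsJDen (Q : Set E3) (β : Form2) (f : Ph → ℝ) (η : Form3) : Prop :=
  ContinuousOn η Q ∧
    ∀ ψ, IsTest Q ψ → integ3 Q ψ η = pairQ Q β (dd ψ) + pairD Q f (fun z => -ψ z.1)

/-- The `+`Lie-Poisson bracket, at `(β, Π)`, of two linear functionals
`⟨β, α⟩ + ⟨Π, X⟩`, `⟨β, α'⟩ + ⟨Π, Y⟩`. The first factor `dF(Q)` is abelian and does not contribute;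
the bracket of `𝔤` is minus the Jacobi-Lie bracket. -/
def lpBracket (Q : Set E3) (P : PhForm) (X Y : Ph → Ph) : ℝ :=
  pairT Q P (fun z => -VectorField.lieBracket ℝ X Y z)

/-- Partial gradients of a function on phase space. -/
def gradQ (k : Ph → ℝ) (z : Ph) : E3 := ∇ (fun q => k (q, z.2)) z.1

def gradP (k : Ph → ℝ) (z : Ph) : E3 := ∇ (fun p => k (z.1, p)) z.2

/-- The canonical Poisson bracket on functions on phase space. -/
def poisson (k h : Ph → ℝ) (z : Ph) : ℝ := ⟪gradQ k z, gradP h z⟫ - ⟪gradP k z, gradQ h z⟫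

/-- The Lie-Poisson bracket, at `f dμ`, of the linear functionals `⟨f dμ, k⟩` and `⟨f dμ, h⟩`. -/
def lpBracketDen (Q : Set E3) (f k h : Ph → ℝ) : ℝ := pairD Q f (poisson k h)

/-! ### The dynamical equations -/

/-- The Hamiltonian vector field `∇_p h · ∇_q - ∇_q h · ∇_p`. -/
def hamField (h : Ph → ℝ) (z : Ph) : Ph := (gradP h z, -gradQ h z)

/-- The energy `p²/2m + eφ(q)` of a particle of mass `m` and charge `c`. -/
def energy (m c : ℝ) (φ : E3 → ℝ) (z : Ph) : ℝ := ‖z.2‖ ^ 2 / (2 * m) + c * φ z.1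

/-- The momentum-Vlasov equations at times `t ∈ I`, with potential `φ t`:
`∂Π_q/∂t = -X_h(Π_q) + c (Π_p · ∇_q) ∇_q φ`, `∂Π_p/∂t = -X_h(Π_p) - (1/m) Π_q`. -/
def MomentumVlasov (Q : Set E3) (m c : ℝ) (I : Set ℝ) (φ : ℝ → E3 → ℝ) (P : ℝ → PhForm) : Prop :=
  ∀ t ∈ I, ∀ z ∈ phase Q,
    HasDerivAt (fun s => momQ (P s) z)
      (-(fderiv ℝ (momQ (P t)) z (hamField (energy m c (φ t)) z))
        + c • fderiv ℝ (∇ (φ t)) z.1 (momP (P t) z)) t ∧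
    HasDerivAt (fun s => momP (P s) z)
      (-(fderiv ℝ (momP (P t)) z (hamField (energy m c (φ t)) z)) - (1 / m) • momQ (P t) z) t

/-- The Vlasov equation at times `t ∈ I`, with potential `φ t`:
`∂f/∂t + (p/m) · ∇_q f - c ∇_q φ · ∇_p f = 0`. -/
def Vlasov (Q : Set E3) (m c : ℝ) (I : Set ℝ) (φ : ℝ → E3 → ℝ) (f : ℝ → Ph → ℝ) : Prop :=
  ∀ t ∈ I, ∀ z ∈ phase Q, ∃ f' : ℝ, HasDerivAt (fun s => f s z) f' t ∧
    f' + ⟪(1 / m) • z.2, gradQ (f t) z⟫ - c * ⟪∇ (φ t) z.1, gradP (f t) z⟫ = 0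

/-- The Poisson equation `∇²φ = -c ∫ f d³p` on `Q`. -/
def PoissonEq (Q : Set E3) (c : ℝ) (φ : E3 → ℝ) (f : Ph → ℝ) : Prop :=
  ∀ q ∈ Q, Laplacian.laplacian φ q = -c * ∫ p, f (q, p)

end PoissonVlasov

end

open PoissonVlasov

noncomputable section

namespace PoissonVlasov

variable {Q : Set E3}

/-! On the gauge side, the derivative of a fibre translation differs from the identity only by the
Hessian of `φ`, and symmetry of the Hessian makes it symplectic. A vertical Hamiltonian field has a
Hamiltonian function with zero momentum derivative, hence one constant on each fibre ℝ³; this gives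
`vertical_iff`.

The momentum maps are defined by duality and computed by integrating by parts against a test
function `ψ`. On `Q` this is Green's identity (`IsFun.pairQ_star`), once α ∧ *α' and d*dφ have been
evaluated; both are cases of the contraction identity `uncurry_vol3_curry`. On `T*Q` the integration
by parts is in `q` with `p` frozen (`IsDecayForm.pairT_ver`), and Fubini then turns the result into
a fibre integral, with fibre domination providing integrability and continuity in `q`. Each
functional thus becomes ∫ ψ D with `D` continuous, and `represents_iff` says that D d³q is the only
continuous density with this property. The two forms of the Poisson constraint agree because ∇_p ·
Π_q integrates to zero over each fibre (`IsDecayForm.integral_divP`).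

For the momentum property, a measure-preserving shear moves the parameter `s` from the form or
density, which need only be continuous, onto the smooth compactly supported `X` or `k`.
Differentiating under the integral (`hasDerivAt_setIntegral_clm_apply`) then produces the
Lie–Poisson bracket.

The dynamical equivalences are the zero-set statements applied at each time. The passage to the
Vlasov equation rests on `divP_sub_divQ_momentumVlasov`: taking ∇_p · of the first equation minus
∇_q · of the second, the 1/m terms cancel and the Hessian terms cancel by tr(HL) = tr(LH), leaving
only transport of the density. -/

theorem fderiv_clm_comp {E F G : Type*} [NormedAddCommGroup E] [NormedSpace ℝ E]
    [NormedAddCommGroup F] [NormedSpace ℝ F] [NormedAddCommGroup G] [NormedSpace ℝ G]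
    (L : F →L[ℝ] G) {f : E → F} {x : E} (h : DifferentiableAt ℝ f x) :
    fderiv ℝ (fun y => L (f y)) x = L ∘L fderiv ℝ f x :=
  (L.hasFDerivAt.comp x h.hasFDerivAt).fderiv

/-! ### Coordinates, three-forms and the Riesz map -/

theorem stdE_apply (i j : Fin 3) : stdE i j = if j = i then 1 else 0 := by
  simp [stdE, PiLp.single_apply]

theorem inner_stdE_right (v : E3) (i : Fin 3) : ⟪v, stdE i⟫ = v i := by
  simp [stdE, EuclideanSpace.inner_single_right]

theorem inner_eq_sum (u v : E3) : ⟪u, v⟫ = ∑ i, u i * v i := by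
  simp [PiLp.inner_apply, mul_comm]

theorem eq_sum_stdE (v : E3) : v = ∑ i, v i • stdE i := by
  ext j
  simp [stdE_apply, Finset.sum_apply]

theorem map_eq_sum_stdE {F : Type*} [NormedAddCommGroup F] [NormedSpace ℝ F] (L : E3 →L[ℝ] F)
    (v : E3) : L v = ∑ i, v i • L (stdE i) := by
  conv_lhs => rw [eq_sum_stdE v]
  simp

theorem vol3_apply (v : Fin 3 → E3) :
    vol3 v = v 0 0 * v 1 1 * v 2 2 - v 0 0 * v 1 2 * v 2 1 - v 0 1 * v 1 0 * v 2 2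
      + v 0 1 * v 1 2 * v 2 0 + v 0 2 * v 1 0 * v 2 1 - v 0 2 * v 1 1 * v 2 0 :=
  Matrix.det_fin_three (Matrix.of fun i j => v i j)

theorem vol3_stdE : vol3 stdE = 1 := by
  simp [vol3_apply, stdE_apply]

/-- Top-degree forms are a line: each is its value on the basis times the determinant. -/
theorem form3_ext {a b : E3 [⋀^Fin 3]→L[ℝ] ℝ} (h : a stdE = b stdE) : a = b := by
  apply ContinuousAlternatingMap.toAlternatingMap_injective
  have key : ∀ c : E3 [⋀^Fin 3]→L[ℝ] ℝ, c.toAlternatingMap =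
      c stdE • (EuclideanSpace.basisFun (Fin 3) ℝ).toBasis.det := by
    intro c
    rw [c.toAlternatingMap.eq_smul_basis_det (EuclideanSpace.basisFun (Fin 3) ℝ).toBasis]
    congr 1
    show c _ = c _
    congr 1
    ext i j
    simp [stdE]
  rw [key a, key b, h]

theorem form3_eq_smul (a : E3 [⋀^Fin 3]→L[ℝ] ℝ) : a = a stdE • vol3 := by
  apply form3_ext
  simp [vol3_stdE]

/-- The gradient is the vector field dual to the differential. -/
theorem toDual_symm_dd (φ : E3 → ℝ) (q : E3) :
    (InnerProductSpace.toDual ℝ E3).symm (dd φ q) = ∇ φ q := rfl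

theorem toDual_symm_apply' (l : E3 →L[ℝ] ℝ) (i : Fin 3) :
    (InnerProductSpace.toDual ℝ E3).symm l i = l (stdE i) := by
  rw [← inner_stdE_right, InnerProductSpace.toDual_symm_apply]

theorem gradient_apply (φ : E3 → ℝ) (q : E3) (i : Fin 3) : ∇ φ q i = fderiv ℝ φ q (stdE i) :=
  toDual_symm_apply' _ i

theorem inner_gradient_left (φ : E3 → ℝ) (q v : E3) : ⟪∇ φ q, v⟫ = fderiv ℝ φ q v := by
  rw [← toDual_symm_dd, InnerProductSpace.toDual_symm_apply]; rfl

/-- The Riesz isomorphism from covectors to vectors, as a continuous linear map. -/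
def rieszCLM : (E3 →L[ℝ] ℝ) →L[ℝ] E3 where
  toFun l := (InnerProductSpace.toDual ℝ E3).symm l
  map_add' := by simp
  map_smul' := by simp
  cont := (InnerProductSpace.toDual ℝ E3).symm.continuous

theorem rieszCLM_apply (l : E3 →L[ℝ] ℝ) (i : Fin 3) : rieszCLM l i = l (stdE i) :=
  toDual_symm_apply' l i

/-! ### Hodge star and Laplacian -/

theorem gradient_eq (φ : E3 → ℝ) : ∇ φ = fun q => rieszCLM (fderiv ℝ φ q) := rfl

/-- Alternatising (v, ·, ·) ↦ vol(Lv, ·, ·) gives tr(L) vol: the i-th term is the determinant with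
`e_i` replaced by `L e_i`. A rank-one `L` yields the wedge with a Hodge star; `L` equal to the
Hessian yields d*dφ. -/
theorem uncurry_vol3_curry (L : E3 →L[ℝ] E3) :
    ContinuousAlternatingMap.alternatizeUncurryFin (vol3.curryLeft ∘L L) stdE
      = ∑ i, L (stdE i) i := by
  rw [ContinuousAlternatingMap.alternatizeUncurryFin_apply]
  have h (v : E3) (w : Fin 2 → E3) :
      vol3.curryLeft v w = vol3 (Matrix.vecCons v w) := rfl
  simp [Fin.sum_univ_three, h, vol3_apply, stdE_apply, Fin.removeNth, Fin.succAbove]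

theorem wedge12_star1 (α α' : Form1) (q : E3) :
    wedge12 α (star1 α') q stdE = ∑ i, α q (stdE i) * α' q (stdE i) := by
  have : (α q).smulRight (star1 α' q) = vol3.curryLeft ∘L
      ((α q).smulRight ((InnerProductSpace.toDual ℝ E3).symm (α' q))) := by
    ext v
    simp [star1]
  rw [wedge12, this, uncurry_vol3_curry]
  simp [toDual_symm_apply']

theorem laplacian_eq_sum (φ : E3 → ℝ) (q : E3) :
    Laplacian.laplacian φ q = ∑ i, fderiv ℝ (fderiv ℝ φ) q (stdE i) (stdE i) := by
  rw [InnerProductSpace.laplacian_eq_iteratedFDeriv_orthonormalBasis φ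
    (EuclideanSpace.basisFun (Fin 3) ℝ)]
  simp [iteratedFDeriv_two_apply, stdE]

theorem extDeriv_star1_dd {φ : E3 → ℝ} {q : E3} (h : ContDiffAt ℝ 2 φ q) :
    extDeriv (star1 (dd φ)) q = Laplacian.laplacian φ q • vol3 := by
  have hd : DifferentiableAt ℝ (fderiv ℝ φ) q :=
    (h.fderiv_right (m := 1) (by norm_num)).differentiableAt (by norm_num)
  -- The star of dφ is a constant linear map applied to `fderiv ℝ φ`, so differentiating it only
  -- composes that map with the Hessian.
  have e : star1 (dd φ) = fun y => (vol3.curryLeft ∘L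
    rieszCLM)
      (fderiv ℝ φ y) := rfl
  apply form3_ext
  rw [extDeriv, e, fderiv_clm_comp _ hd,
    ContinuousLinearMap.comp_assoc, uncurry_vol3_curry, laplacian_eq_sum]
  simp [rieszCLM_apply, vol3_stdE]

/-! ### Components and divergences of one-forms on phase space -/

theorem momP_apply (P : PhForm) (z : Ph) (i : Fin 3) : momP P z i = P z (0, stdE i) := by
  simp [momP, toDual_symm_apply']

theorem momQ_apply (P : PhForm) (z : Ph) (i : Fin 3) : momQ P z i = P z (stdE i, 0) := by
  simp [momQ, toDual_symm_apply']

theorem inner_momP (P : PhForm) (z : Ph) (v : E3) : ⟪momP P z, v⟫ = P z (0, v) := by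
  simp [momP]

/-- The fibre component of a covector, as a continuous linear map. -/
def fibreCLM : (Ph →L[ℝ] ℝ) →L[ℝ] E3 :=
  rieszCLM ∘L
    (ContinuousLinearMap.compL ℝ E3 Ph ℝ).flip (ContinuousLinearMap.inr ℝ E3 E3)

/-- The base component of a covector, as a continuous linear map. -/
def baseCLM : (Ph →L[ℝ] ℝ) →L[ℝ] E3 :=
  rieszCLM ∘L
    (ContinuousLinearMap.compL ℝ E3 Ph ℝ).flip (ContinuousLinearMap.inl ℝ E3 E3)

theorem momP_eq (P : PhForm) : momP P = fun z => fibreCLM (P z) := rfl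

theorem momQ_eq (P : PhForm) : momQ P = fun z => baseCLM (P z) := rfl

theorem fibreCLM_apply (l : Ph →L[ℝ] ℝ) (i : Fin 3) : fibreCLM l i = l (0, stdE i) :=
  momP_apply (fun _ => l) 0 i

theorem baseCLM_apply (l : Ph →L[ℝ] ℝ) (i : Fin 3) : baseCLM l i = l (stdE i, 0) :=
  momQ_apply (fun _ => l) 0 i

theorem fderiv_momP {P : PhForm} {z : Ph} (h : DifferentiableAt ℝ P z) (v : Ph) :
    fderiv ℝ (momP P) z v = fibreCLM (fderiv ℝ P z v) := by
  rw [momP_eq, fderiv_clm_comp _ h]; rfl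

theorem fderiv_momQ {P : PhForm} {z : Ph} (h : DifferentiableAt ℝ P z) (v : Ph) :
    fderiv ℝ (momQ P) z v = baseCLM (fderiv ℝ P z v) := by
  rw [momQ_eq, fderiv_clm_comp _ h]; rfl

theorem divQ_momP {P : PhForm} {z : Ph} (h : DifferentiableAt ℝ P z) :
    divQ (momP P) z = ∑ i, fderiv ℝ P z (stdE i, 0) (0, stdE i) := by
  simp [divQ, fderiv_momP h, fibreCLM_apply]

theorem divP_momQ {P : PhForm} {z : Ph} (h : DifferentiableAt ℝ P z) :
    divP (momQ P) z = ∑ i, fderiv ℝ P z (0, stdE i) (stdE i, 0) := by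
  simp [divP, fderiv_momQ h, baseCLM_apply]

theorem density_eq (P : PhForm) (z : Ph) :
    density P z = divP (momQ P) z - divQ (momP P) z := by
  have : fderiv ℝ (fun y => -momP P y) z = -fderiv ℝ (momP P) z := fderiv_neg
  simp [density, phaseDiv, sharp, divQ, this]
  ring

/-! ### Gradients of functions smooth on `Q` -/

theorem isOpen_phase (hQ : IsOpen Q) : IsOpen (phase Q) := hQ.prod isOpen_univ

theorem mem_phase {z : Ph} : z ∈ phase Q ↔ z.1 ∈ Q := by simp [phase]

theorem IsFun.contDiffAt {φ : E3 → ℝ} (h : IsFun Q φ) (hQ : IsOpen Q) {q : E3} (hq : q ∈ Q) :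
    ContDiffAt ℝ ∞ φ q := ContDiffOn.contDiffAt h (hQ.mem_nhds hq)

theorem IsFun.differentiableAt {φ : E3 → ℝ} (h : IsFun Q φ) (hQ : IsOpen Q) {q : E3}
    (hq : q ∈ Q) : DifferentiableAt ℝ φ q :=
  (h.contDiffAt hQ hq).differentiableAt (by simp)

theorem contDiffAt_gradient {φ : E3 → ℝ} {q : E3} (h : ContDiffAt ℝ ∞ φ q) :
    ContDiffAt ℝ ∞ (∇ φ) q := by
  rw [gradient_eq]
  exact rieszCLM.contDiff.contDiffAt.comp q (h.fderiv_right (m := ∞) (by simp))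

theorem IsFun.contDiffOn_gradient {φ : E3 → ℝ} (h : IsFun Q φ) (hQ : IsOpen Q) :
    ContDiffOn ℝ ∞ (∇ φ) Q :=
  fun _ hq => (contDiffAt_gradient (h.contDiffAt hQ hq)).contDiffWithinAt

theorem IsFun.differentiableAt_gradient {φ : E3 → ℝ} (h : IsFun Q φ) (hQ : IsOpen Q) {q : E3}
    (hq : q ∈ Q) : DifferentiableAt ℝ (∇ φ) q :=
  (contDiffAt_gradient (h.contDiffAt hQ hq)).differentiableAt (by simp)

theorem inner_fderiv_gradient {φ : E3 → ℝ} {q : E3} (h : ContDiffAt ℝ ∞ φ q) (u v : E3) :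
    ⟪fderiv ℝ (∇ φ) q u, v⟫ = fderiv ℝ (fderiv ℝ φ) q u v := by
  have hd : DifferentiableAt ℝ (fderiv ℝ φ) q :=
    (h.fderiv_right (m := ∞) (by simp)).differentiableAt (by simp)
  rw [gradient_eq, fderiv_clm_comp _ hd]
  exact InnerProductSpace.toDual_symm_apply

theorem fderiv_gradient_symm {φ : E3 → ℝ} {q : E3} (h : ContDiffAt ℝ ∞ φ q) (u v : E3) :
    ⟪fderiv ℝ (∇ φ) q u, v⟫ = ⟪u, fderiv ℝ (∇ φ) q v⟫ := by
  rw [real_inner_comm _ u, inner_fderiv_gradient h, inner_fderiv_gradient h]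
  -- The side goal is the minimal smoothness (two over ℝ) for which the second derivative is
  -- symmetric.
  exact (h.isSymmSndFDerivAt (by simpa using ENat.LEInfty.out)).eq u v

theorem gradient_add {φ ψ : E3 → ℝ} {q : E3} (hφ : DifferentiableAt ℝ φ q)
    (hψ : DifferentiableAt ℝ ψ q) : ∇ (φ + ψ) q = ∇ φ q + ∇ ψ q := by
  simp only [gradient_eq, fderiv_add hφ hψ, map_add]

theorem gradient_smul (φ : E3 → ℝ) (a : ℝ) (q : E3) : ∇ (a • φ) q = a • ∇ φ q := by
  simp only [gradient_eq, fderiv_const_smul_field, Pi.smul_apply, map_smul]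

/-! ### Fibre translations and vertical lifts -/

theorem ver_dd (φ : E3 → ℝ) (z : Ph) : ver (dd φ) z = (0, ∇ φ z.1) := rfl

theorem ver_neg_dd (φ : E3 → ℝ) (z : Ph) : ver (-dd φ) z = (0, -∇ φ z.1) := by
  simp [ver, ← toDual_symm_dd]

theorem hasFDerivAt_fibreShift {φ : E3 → ℝ} {z : Ph} (h : DifferentiableAt ℝ (∇ φ) z.1) :
    HasFDerivAt (fibreShift φ)
      ((ContinuousLinearMap.fst ℝ E3 E3).prod (ContinuousLinearMap.snd ℝ E3 E3 -
        fderiv ℝ (∇ φ) z.1 ∘L ContinuousLinearMap.fst ℝ E3 E3)) z :=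
  hasFDerivAt_fst.prodMk (hasFDerivAt_snd.sub (h.hasFDerivAt.comp z hasFDerivAt_fst))

theorem fderiv_fibreShift {φ : E3 → ℝ} {z : Ph} (h : DifferentiableAt ℝ (∇ φ) z.1) (v : Ph) :
    fderiv ℝ (fibreShift φ) z v = (v.1, v.2 - fderiv ℝ (∇ φ) z.1 v.1) := by
  rw [(hasFDerivAt_fibreShift h).fderiv]; rfl

theorem fibreShift_zero (z : Ph) : fibreShift 0 z = z := by
  have : ∇ (0 : E3 → ℝ) z.1 = 0 := gradient_fun_const _ _
  simp [fibreShift, this]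

theorem fibreShift_add {φ ψ : E3 → ℝ} {z : Ph} (hφ : DifferentiableAt ℝ φ z.1)
    (hψ : DifferentiableAt ℝ ψ z.1) :
    fibreShift (φ + ψ) z = fibreShift φ (fibreShift ψ z) := by
  simp only [fibreShift, gradient_add hφ hψ]
  congr 1
  abel

theorem contDiffOn_fibreShift {φ : E3 → ℝ} (h : IsFun Q φ) (hQ : IsOpen Q) :
    ContDiffOn ℝ ∞ (fibreShift φ) (phase Q) :=
  contDiffOn_fst.prodMk (contDiffOn_snd.sub
    ((h.contDiffOn_gradient hQ).comp contDiffOn_fst fun _ hz => mem_phase.1 hz))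

/-- With `H` the Hessian, the correction terms are ⟪u.1, H v.1⟫ and -⟪H u.1, v.1⟫; they cancel
because `H` is symmetric. -/
theorem symp_fibreShift {φ : E3 → ℝ} {z : Ph} (h : ContDiffAt ℝ ∞ φ z.1) (u v : Ph) :
    symp (fderiv ℝ (fibreShift φ) z u) (fderiv ℝ (fibreShift φ) z v) = symp u v := by
  have hd := (contDiffAt_gradient h).differentiableAt (by simp)
  simp only [fderiv_fibreShift hd, symp, inner_sub_left, inner_sub_right,
    fderiv_gradient_symm h]
  ring

theorem hasDerivAt_fibreShift (φ : E3 → ℝ) (z : Ph) :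
    HasDerivAt (fun s : ℝ => fibreShift (s • φ) z) (ver (-dd φ) z) 0 := by
  simp only [fibreShift, gradient_smul, ver_neg_dd]
  have := ((hasDerivAt_id (0 : ℝ)).smul_const (∇ φ z.1)).const_sub z.2
  exact (hasDerivAt_const _ _).prodMk (by simpa using this)

theorem isHamiltonianFor_ver_neg {φ : E3 → ℝ} (h : IsFun Q φ) (hQ : IsOpen Q) :
    IsHamiltonianFor Q (ver (-dd φ)) (fun z => φ z.1) := by
  intro z hz v
  have := (h.differentiableAt hQ (mem_phase.1 hz)).hasFDerivAt.comp z hasFDerivAt_fst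
  rw [show fderiv ℝ (fun z : Ph => φ z.1) z = _ from this.fderiv]
  simp [ver_neg_dd, symp]

theorem isHamiltonianFor_ver {φ : E3 → ℝ} (h : IsFun Q φ) (hQ : IsOpen Q) :
    IsHamiltonianFor Q (ver (dd φ)) (fun z => -φ z.1) := by
  intro z hz v
  have := ((h.differentiableAt hQ (mem_phase.1 hz)).hasFDerivAt.comp z hasFDerivAt_fst).neg
  rw [show fderiv ℝ (fun z : Ph => -φ z.1) z = _ from this.fderiv]
  simp [ver_dd, symp]

theorem contDiffOn_ver {φ : E3 → ℝ} (h : IsFun Q φ) (hQ : IsOpen Q) :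
    ContDiffOn ℝ ∞ (ver (dd φ)) (phase Q) :=
  contDiffOn_const.prodMk ((h.contDiffOn_gradient hQ).comp contDiffOn_fst fun _ hz => mem_phase.1 hz)

theorem isHamField_ver {φ : E3 → ℝ} (h : IsFun Q φ) (hQ : IsOpen Q) :
    IsHamField Q (ver (dd φ)) :=
  ⟨contDiffOn_ver h hQ, _, (ContDiffOn.comp h contDiffOn_fst fun _ hz => mem_phase.1 hz).neg,
    isHamiltonianFor_ver h hQ⟩

theorem ver_linear {φ ψ : E3 → ℝ} {z : Ph} (hφ : DifferentiableAt ℝ φ z.1)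
    (hψ : DifferentiableAt ℝ ψ z.1) (a b : ℝ) :
    ver (dd (a • φ + b • ψ)) z = a • ver (dd φ) z + b • ver (dd ψ) z := by
  simp [ver_dd, gradient_add (hφ.const_smul a) (hψ.const_smul b), gradient_smul]

theorem fderiv_ver {φ : E3 → ℝ} {z : Ph} (h : DifferentiableAt ℝ (∇ φ) z.1) (v : Ph) :
    fderiv ℝ (ver (dd φ)) z v = (0, fderiv ℝ (∇ φ) z.1 v.1) := by
  have : HasFDerivAt (ver (dd φ)) _ z :=
    (hasFDerivAt_const (0 : E3) z).prodMk (h.hasFDerivAt.comp z hasFDerivAt_fst)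
  rw [this.fderiv]; rfl

theorem lieBracket_ver {φ ψ : E3 → ℝ} {z : Ph} (hφ : DifferentiableAt ℝ (∇ φ) z.1)
    (hψ : DifferentiableAt ℝ (∇ ψ) z.1) :
    VectorField.lieBracket ℝ (ver (dd φ)) (ver (dd ψ)) z = 0 := by
  simp [VectorField.lieBracket, fderiv_ver hφ, fderiv_ver hψ, ver_dd]

theorem eqOn_ver_iff (φ ψ : E3 → ℝ) :
    EqOn (ver (dd φ)) (ver (dd ψ)) (phase Q) ↔ EqOn (dd φ) (dd ψ) Q := by
  constructor
  · intro h q hq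
    have := congrArg Prod.snd (h (show ((q, 0) : Ph) ∈ phase Q from mem_phase.2 hq))
    exact (InnerProductSpace.toDual ℝ E3).symm.injective this
  · intro h z hz
    simp only [ver, h (mem_phase.1 hz)]

theorem eqOn_dd_iff {φ ψ : E3 → ℝ} (hφ : IsFun Q φ) (hψ : IsFun Q ψ) (hQ : IsOpen Q)
    (hc : IsPreconnected Q) : EqOn (dd φ) (dd ψ) Q ↔ ∃ a : ℝ, ∀ q ∈ Q, φ q = ψ q + a := by
  constructor
  · intro h
    have hd : DifferentiableOn ℝ (φ - ψ) Q := fun q hq =>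
      ((hφ.differentiableAt hQ hq).sub (hψ.differentiableAt hQ hq)).differentiableWithinAt
    obtain ⟨a, ha⟩ := hQ.exists_is_const_of_fderiv_eq_zero hc hd fun q hq => by
      rw [fderiv_sub (hφ.differentiableAt hQ hq) (hψ.differentiableAt hQ hq)]
      exact sub_eq_zero.2 (h hq)
    exact ⟨a, fun q hq => by have := ha q hq; simp only [Pi.sub_apply] at this; linarith⟩
  · rintro ⟨a, ha⟩ q hq
    have : φ =ᶠ[nhds q] fun y => ψ y + a := by
      filter_upwards [hQ.mem_nhds hq] using ha
    simp [dd, this.fderiv_eq]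

/-- Pairing a vertical `X` with vertical vectors shows that `h` has no momentum derivative, so it is
constant on each fibre. The potential is -h(q, 0), since ver(dφ) has Hamiltonian function -φ. -/
theorem vertical_iff (hQ : IsOpen Q) (X : Ph → Ph) :
    (IsHamField Q X ∧ ∀ z ∈ phase Q, (X z).1 = 0) ↔
      ∃ φ, IsFun Q φ ∧ EqOn X (ver (dd φ)) (phase Q) := by
  constructor
  · rintro ⟨⟨-, h, hh, hX⟩, hv⟩
    have hd : ∀ z ∈ phase Q, DifferentiableAt ℝ h z := fun z hz =>
      (hh.contDiffAt ((isOpen_phase hQ).mem_nhds hz)).differentiableAt (by simp)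
    have hfib : ∀ z ∈ phase Q, ∀ w : E3, fderiv ℝ h z (0, w) = 0 := fun z hz w => by
      have := hX z hz (0, w)
      simp only [symp, hv z hz, inner_zero_left, inner_zero_right] at this
      linarith
    have hconst : ∀ q ∈ Q, ∀ p, h (q, p) = h (q, 0) := fun q hq p => by
      have hz : ∀ p, (q, p) ∈ phase Q := fun p => mem_phase.2 hq
      have hp : ∀ p, HasFDerivAt (fun p : E3 => h (q, p))
          (fderiv ℝ h (q, p) ∘L ContinuousLinearMap.inr ℝ E3 E3) p := fun p =>
        (hd _ (hz p)).hasFDerivAt.comp p (hasFDerivAt_prodMk_right q p)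
      refine is_const_of_fderiv_eq_zero (fun p => (hp p).differentiableAt) (fun p => ?_) p 0
      rw [(hp p).fderiv]
      ext w
      simp [hfib _ (hz p)]
    have hφ : IsFun Q fun q => -h (q, 0) :=
      (hh.comp (contDiff_id.prodMk contDiff_const).contDiffOn fun q hq => mem_phase.2 hq).neg
    refine ⟨_, hφ, fun z hz => ?_⟩
    have e : h =ᶠ[nhds z] fun y => -(-h (y.1, 0)) := by
      filter_upwards [(isOpen_phase hQ).mem_nhds hz] with y hy
      simpa using hconst y.1 (mem_phase.1 hy) y.2
    -- Both fields have Hamiltonian functions that agree near `z`. As both are vertical, pairing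
    -- with the vectors (v, 0) already determines them.
    have key : ∀ v, symp (X z) v = symp (ver (dd fun q => -h (q, 0)) z) v := fun v => by
      rw [hX z hz, isHamiltonianFor_ver hφ hQ z hz, e.fderiv_eq]
    refine Prod.ext (hv z hz) (ext_inner_right ℝ fun v => ?_)
    simpa [symp, hv z hz, ver] using key (v, 0)
  · rintro ⟨φ, hφ, hX⟩
    obtain ⟨h1, h, h2, h3⟩ := isHamField_ver hφ hQ
    exact ⟨⟨h1.congr hX, h, h2, fun z hz v => by rw [hX hz, h3 z hz]⟩,
      fun z hz => by rw [hX hz]; rfl⟩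

/-! ### Test functions and integration by parts on `Q` -/

/-- Continuous functions with compact support in `Q`. -/
def IsCutoff (Q : Set E3) (ψ : E3 → ℝ) : Prop :=
  Continuous ψ ∧ HasCompactSupport ψ ∧ tsupport ψ ⊆ Q

theorem IsTest.isCutoff {ψ : E3 → ℝ} (h : IsTest Q ψ) : IsCutoff Q ψ :=
  ⟨h.1.continuous, h.2.1, h.2.2⟩

theorem IsTest.isCutoff_fderiv {ψ : E3 → ℝ} (h : IsTest Q ψ) (v : E3) :
    IsCutoff Q fun q => fderiv ℝ ψ q v :=
  ⟨(h.1.continuous_fderiv (by simp)).clm_apply continuous_const, h.2.1.fderiv_apply ℝ v,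
    (tsupport_fderiv_apply_subset ℝ v).trans h.2.2⟩

theorem IsCutoff.eq_zero {ψ : E3 → ℝ} (h : IsCutoff Q ψ) {q : E3} (hq : q ∉ Q) : ψ q = 0 :=
  image_eq_zero_of_notMem_tsupport fun hx => hq (h.2.2 hx)

/-- The support of `ψ` lies inside the open set `Q`, so the product is continuous on all of ℝ³
whatever values `g` takes outside `Q`. -/
theorem IsCutoff.integrable_mul {ψ g : E3 → ℝ} (h : IsCutoff Q ψ) (hQ : IsOpen Q)
    (hg : ContinuousOn g Q) : Integrable fun q => ψ q * g q := by
  have hs : tsupport (fun q => ψ q * g q) ⊆ tsupport ψ := tsupport_mul_subset_left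
  have hc : Continuous fun q => ψ q * g q :=
    ContinuousOn.continuous_of_tsupport_subset (h.1.continuousOn.mul hg) hQ (hs.trans h.2.2)
  exact hc.integrable_of_hasCompactSupport (h.2.1.mul_right)

theorem IsCutoff.setIntegral_mul {ψ : E3 → ℝ} (h : IsCutoff Q ψ) (g : E3 → ℝ) :
    ∫ q in Q, ψ q * g q = ∫ q, ψ q * g q :=
  setIntegral_eq_integral_of_forall_compl_eq_zero fun q hq => by simp [h.eq_zero hq]

theorem IsTest.integral_fderiv_mul {ψ g : E3 → ℝ} (h : IsTest Q ψ) (hQ : IsOpen Q) (v : E3)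
    (hg : ∀ q ∈ Q, DifferentiableAt ℝ g q) (hg' : ContinuousOn (fun q => fderiv ℝ g q v) Q) :
    ∫ q in Q, fderiv ℝ ψ q v * g q = -∫ q in Q, ψ q * fderiv ℝ g q v := by
  have hc : ContinuousOn g Q := fun q hq => (hg q hq).continuousAt.continuousWithinAt
  rw [h.isCutoff.setIntegral_mul, (h.isCutoff_fderiv v).setIntegral_mul,
    integral_mul_fderiv_eq_neg_fderiv_mul_of_integrable
      ((h.isCutoff_fderiv v).integrable_mul hQ hc) (h.isCutoff.integrable_mul hQ hg')
      (h.isCutoff.integrable_mul hQ hc)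
      (fun q _ => h.1.differentiable (by simp) q) fun q hq => hg q (h.2.2 hq), neg_neg]

/-- Integration by parts against the constant 1; integrability replaces compact support. -/
theorem integral_fderiv_eq_zero {g : E3 → ℝ} (v : E3) (hg : Differentiable ℝ g)
    (hi : Integrable g) (hi' : Integrable fun q => fderiv ℝ g q v) :
    ∫ q, fderiv ℝ g q v = 0 := by
  simpa using integral_mul_fderiv_eq_neg_fderiv_mul_of_integrable (μ := volume)
    (f := fun _ : E3 => (1 : ℝ)) (g := g) (v := v) (by simp) (by simpa using hi')
    (by simpa using hi) (fun _ _ => differentiableAt_const _) fun q _ => hg q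

/-! ### Fibre integrals and Fubini -/

theorem restrict_phase (Q : Set E3) :
    (volume : Measure Ph).restrict (phase Q) = (volume.restrict Q).prod volume := by
  rw [phase, Measure.volume_eq_prod, ← Measure.prod_restrict, Measure.restrict_univ]

theorem continuous_fibre {G : Ph → ℝ} (hG : ContinuousOn G (phase Q)) {q : E3} (hq : q ∈ Q) :
    Continuous fun p => G (q, p) :=
  hG.comp_continuous (by fun_prop) fun _ => mem_phase.2 hq

theorem FibreDominated.integrable_fibre {G : Ph → ℝ} (h : FibreDominated Q G)
    (hG : ContinuousOn G (phase Q)) {q : E3} (hq : q ∈ Q) : Integrable fun p => G (q, p) := by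
  obtain ⟨b, hb, hGb⟩ := h {q} (by simpa using hq) isCompact_singleton
  exact hb.mono' (continuous_fibre hG hq).aestronglyMeasurable
    (Filter.Eventually.of_forall fun p => hGb q rfl p)

/-- Dominated convergence, with the single bound `b` belonging to a compact neighbourhood of `q`
inside `Q`. -/
theorem FibreDominated.continuousOn_integral {G : Ph → ℝ} (h : FibreDominated Q G)
    (hG : ContinuousOn G (phase Q)) (hQ : IsOpen Q) : ContinuousOn (fun q => ∫ p, G (q, p)) Q := by
  intro q hq
  obtain ⟨K, hK, hqK, hKQ⟩ := exists_compact_subset hQ hq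
  obtain ⟨b, hb, hGb⟩ := h K hKQ hK
  have hK' : ∀ᶠ y in nhds q, y ∈ K := mem_interior_iff_mem_nhds.1 hqK
  refine (continuousAt_of_dominated (bound := b)
    (hK'.mono fun y hy => (continuous_fibre hG (hKQ hy)).aestronglyMeasurable)
    (hK'.mono fun y hy => Filter.Eventually.of_forall fun p => hGb y hy p) hb
    (Filter.Eventually.of_forall fun p => ?_)).continuousWithinAt
  exact ContinuousAt.comp (f := fun y => ((y, p) : Ph)) (g := G)
    (hG.continuousAt ((isOpen_phase hQ).mem_nhds (mem_phase.2 hq))) (by fun_prop)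

/-- The dominating function is |ψ(q)| b(p), with `b` taken for the compact set `tsupport ψ`; it is a
product of integrable functions. -/
theorem IsCutoff.integrableOn_mul {ψ : E3 → ℝ} {G : Ph → ℝ} (hψ : IsCutoff Q ψ) (hQ : IsOpen Q)
    (h : FibreDominated Q G) (hG : ContinuousOn G (phase Q)) :
    IntegrableOn (fun z => ψ z.1 * G z) (phase Q) := by
  obtain ⟨b, hb, hGb⟩ := h (tsupport ψ) hψ.2.2 hψ.2.1
  have hi : Integrable (fun z : Ph => ‖ψ z.1‖ * b z.2) :=
    (hψ.1.integrable_of_hasCompactSupport hψ.2.1).norm.mul_prod hb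
  refine hi.integrableOn.mono' ?_ (Filter.Eventually.of_forall fun z => ?_)
  · exact ((hψ.1.comp continuous_fst).continuousOn.mul hG).aestronglyMeasurable
      (isOpen_phase hQ).measurableSet
  · by_cases hz : z.1 ∈ tsupport ψ
    · rw [norm_mul]
      exact mul_le_mul_of_nonneg_left (hGb z.1 hz z.2) (norm_nonneg _)
    · simp [image_eq_zero_of_notMem_tsupport hz]

theorem IsCutoff.integral_phase {ψ : E3 → ℝ} {G : Ph → ℝ} (hψ : IsCutoff Q ψ) (hQ : IsOpen Q)
    (h : FibreDominated Q G) (hG : ContinuousOn G (phase Q)) :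
    ∫ z in phase Q, ψ z.1 * G z = ∫ q in Q, ψ q * ∫ p, G (q, p) := by
  have hi := hψ.integrableOn_mul hQ h hG
  rw [IntegrableOn, restrict_phase] at hi
  rw [restrict_phase, integral_prod _ hi]
  simp only [integral_const_mul]

theorem IsTest.integral_phase_fderiv_mul {ψ : E3 → ℝ} {G : Ph → ℝ} (hψ : IsTest Q ψ)
    (hQ : IsOpen Q) (v : E3) (h : FibreDominated Q G)
    (h' : FibreDominated Q fun z => fderiv ℝ G z (v, 0)) (hG : ∀ z ∈ phase Q, DifferentiableAt ℝ G z)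
    (hG' : ContinuousOn (fun z => fderiv ℝ G z (v, 0)) (phase Q)) :
    ∫ z in phase Q, fderiv ℝ ψ z.1 v * G z = -∫ z in phase Q, ψ z.1 * fderiv ℝ G z (v, 0) := by
  have hc : ContinuousOn G (phase Q) := fun z hz => (hG z hz).continuousAt.continuousWithinAt
  have hi := (hψ.isCutoff_fderiv v).integrableOn_mul hQ h hc
  have hi' := hψ.isCutoff.integrableOn_mul hQ h' hG'
  rw [IntegrableOn, restrict_phase] at hi hi'
  -- Integrating over `q` first reduces the claim to integration by parts on `Q` at frozen `p`.
  rw [restrict_phase, integral_prod_symm _ hi, integral_prod_symm _ hi', ← integral_neg]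
  congr 1 with p
  have hd : ∀ q ∈ Q, HasFDerivAt (fun q => G (q, p))
      (fderiv ℝ G (q, p) ∘L ContinuousLinearMap.inl ℝ E3 E3) q := fun q hq =>
    (hG (q, p) (mem_phase.2 hq)).hasFDerivAt.comp q (hasFDerivAt_prodMk_left q p)
  have he : EqOn (fun q => fderiv ℝ (fun q => G (q, p)) q v) (fun q => fderiv ℝ G (q, p) (v, 0)) Q :=
    fun q hq => by simp [(hd q hq).fderiv]
  rw [hψ.integral_fderiv_mul hQ v (fun q hq => (hd q hq).differentiableAt)
    ((hG'.comp (by fun_prop) fun q hq => mem_phase.2 hq).congr he)]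
  congr 1
  exact setIntegral_congr_fun hQ.measurableSet fun q hq => by
    simp only; rw [show fderiv ℝ (fun q => G (q, p)) q v = _ from he hq]

/-- A continuous density representing a functional on test functions is unique. -/
theorem represents_iff (hQ : IsOpen Q) {D : E3 → ℝ} (hD : ContinuousOn D Q) {R : (E3 → ℝ) → ℝ}
    (hR : ∀ ψ, IsTest Q ψ → R ψ = ∫ q in Q, ψ q * D q) (η : Form3) :
    (ContinuousOn η Q ∧ ∀ ψ, IsTest Q ψ → integ3 Q ψ η = R ψ) ↔
      EqOn η (fun q => D q • vol3) Q := by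
  constructor
  · rintro ⟨hc, h⟩
    have hc' : ContinuousOn (fun q => η q stdE) Q :=
      (continuous_eval_const (F := E3 [⋀^Fin 3]→L[ℝ] ℝ) stdE).comp_continuousOn hc
    -- The fundamental lemma of the calculus of variations gives equality almost everywhere;
    -- continuity on the open set `Q` then makes it pointwise.
    have h0 : ∀ᵐ q ∂volume, q ∈ Q → η q stdE - D q = 0 := by
      refine hQ.ae_eq_zero_of_integral_contDiff_smul_eq_zero
        ((hc'.sub hD).locallyIntegrableOn hQ.measurableSet) fun ψ h1 h2 h3 => ?_
      have hψ : IsTest Q ψ := ⟨h1, h2, h3⟩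
      have := h ψ hψ
      rw [hR ψ hψ, integ3, hψ.isCutoff.setIntegral_mul, hψ.isCutoff.setIntegral_mul] at this
      simp only [smul_eq_mul, mul_sub]
      rw [integral_sub (hψ.isCutoff.integrable_mul hQ hc') (hψ.isCutoff.integrable_mul hQ hD),
        this, sub_self]
    have := Measure.eqOn_open_of_ae_eq (μ := volume) (f := fun q => η q stdE) (g := D)
      ((ae_restrict_iff' hQ.measurableSet).2 (h0.mono fun q h hq => sub_eq_zero.1 (h hq)))
      hQ hc' hD
    intro q hq
    rw [form3_eq_smul (η q)]
    simp only [show η q stdE = D q from this hq]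
  · intro h
    refine ⟨(hD.smul continuousOn_const).congr h, fun ψ hψ => ?_⟩
    rw [hR ψ hψ, integ3]
    exact setIntegral_congr_fun hQ.measurableSet fun q hq => by simp [h hq, vol3_stdE]

/-! ### Decaying forms and their densities -/

theorem FibreDominated.of_le {F G : Type} [NormedAddCommGroup F] [NormedAddCommGroup G]
    {g : Ph → F} {k : Ph → G} (h : FibreDominated Q g) (C : ℝ) (hC : 0 ≤ C)
    (hk : ∀ z ∈ phase Q, ‖k z‖ ≤ C * ‖g z‖) : FibreDominated Q k := by
  intro K hK hKc
  obtain ⟨b, hb, hgb⟩ := h K hK hKc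
  exact ⟨fun p => C * b p, hb.const_mul C, fun q hq p =>
    (hk _ (mem_phase.2 (hK hq))).trans (mul_le_mul_of_nonneg_left (hgb q hq p) hC)⟩

theorem FibreDominated.const_smul {F : Type} [NormedAddCommGroup F] [NormedSpace ℝ F]
    {g : Ph → F} (h : FibreDominated Q g) (c : ℝ) : FibreDominated Q (c • g) :=
  h.of_le ‖c‖ (norm_nonneg c) fun z _ => (norm_smul c (g z)).le

/-- Smooth one-forms on phase space that decay in the fibre with their first derivatives. -/
def IsDecayForm (Q : Set E3) (P : PhForm) : Prop :=
  ContDiffOn ℝ ∞ P (phase Q) ∧ FibreDominated Q P ∧ FibreDominated Q (fderiv ℝ P)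

theorem IsDualForm.isDecayForm {P : PhForm} (h : IsDualForm Q P) : IsDecayForm Q P :=
  ⟨h.1, h.2.1, h.2.2.1⟩

/-- This stability includes c = 0, where `IsDualForm` fails because the density becomes constant. It
is the reason for working with decay alone. -/
theorem IsDecayForm.const_smul {P : PhForm} (h : IsDecayForm Q P) (c : ℝ) :
    IsDecayForm Q (c • P) := by
  refine ⟨h.1.const_smul c, h.2.1.const_smul c, ?_⟩
  have : fderiv ℝ (c • P) = c • fderiv ℝ P :=
    fderiv_const_smul_field (R := ℝ) (E := Ph) (F := Ph →L[ℝ] ℝ) (f := P) c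
  rw [this]
  exact h.2.2.const_smul c

theorem IsDecayForm.contDiffAt {P : PhForm} (h : IsDecayForm Q P) (hQ : IsOpen Q) {z : Ph}
    (hz : z ∈ phase Q) : ContDiffAt ℝ ∞ P z :=
  h.1.contDiffAt ((isOpen_phase hQ).mem_nhds hz)

theorem IsDecayForm.differentiableAt {P : PhForm} (h : IsDecayForm Q P) (hQ : IsOpen Q) {z : Ph}
    (hz : z ∈ phase Q) : DifferentiableAt ℝ P z :=
  (h.contDiffAt hQ hz).differentiableAt (by simp)

theorem IsDecayForm.fibreDominated_apply {P : PhForm} (h : IsDecayForm Q P) (v : Ph) :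
    FibreDominated Q fun z => P z v :=
  h.2.1.of_le ‖v‖ (norm_nonneg v) fun z _ => ((P z).le_opNorm v).trans_eq (mul_comm _ _)

theorem IsDecayForm.fibreDominated_fderiv_apply {P : PhForm} (h : IsDecayForm Q P) (u v : Ph) :
    FibreDominated Q fun z => fderiv ℝ P z u v :=
  h.2.2.of_le (‖u‖ * ‖v‖) (by positivity) fun z _ =>
    ((fderiv ℝ P z).le_opNorm₂ u v).trans_eq (by ring)

theorem FibreDominated.add {F : Type} [NormedAddCommGroup F] {g k : Ph → F}
    (hg : FibreDominated Q g) (hk : FibreDominated Q k) : FibreDominated Q fun z => g z + k z := by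
  intro K hK hKc
  obtain ⟨b, hb, hgb⟩ := hg K hK hKc
  obtain ⟨b', hb', hkb⟩ := hk K hK hKc
  exact ⟨fun p => b p + b' p, hb.add hb', fun q hq p =>
    (norm_add_le _ _).trans (add_le_add (hgb q hq p) (hkb q hq p))⟩

theorem FibreDominated.neg {F : Type} [NormedAddCommGroup F] {g : Ph → F}
    (hg : FibreDominated Q g) : FibreDominated Q fun z => -g z :=
  hg.of_le 1 zero_le_one fun z _ => by simp

theorem FibreDominated.sum {ι F : Type} [NormedAddCommGroup F] (s : Finset ι) {g : ι → Ph → F}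
    (hg : ∀ i ∈ s, FibreDominated Q (g i)) : FibreDominated Q fun z => ∑ i ∈ s, g i z := by
  classical
  induction s using Finset.induction_on with
  | empty => exact fun K _ _ => ⟨0, integrable_zero _ _ _, fun q _ p => by simp⟩
  | insert i s hi ih =>
    simp only [Finset.sum_insert hi]
    exact (hg i (by simp)).add (ih fun j hj => hg j (by simp [hj]))

theorem FibreDominated.congr {F : Type} [NormedAddCommGroup F] {g k : Ph → F}
    (hg : FibreDominated Q g) (h : EqOn k g (phase Q)) : FibreDominated Q k :=
  hg.of_le 1 zero_le_one fun z hz => by simp [h hz]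

theorem IsDecayForm.contDiffOn_fderiv_apply {P : PhForm} (h : IsDecayForm Q P) (hQ : IsOpen Q)
    (u v : Ph) : ContDiffOn ℝ ∞ (fun z => fderiv ℝ P z u v) (phase Q) :=
  ((h.1.fderiv_of_isOpen (isOpen_phase hQ) (m := ∞) (by simp)).clm_apply
    contDiffOn_const).clm_apply contDiffOn_const

theorem IsDecayForm.eqOn_divQ {P : PhForm} (h : IsDecayForm Q P) (hQ : IsOpen Q) :
    EqOn (divQ (momP P)) (fun z => ∑ i, fderiv ℝ P z (stdE i, 0) (0, stdE i)) (phase Q) :=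
  fun _ hz => divQ_momP (h.differentiableAt hQ hz)

theorem IsDecayForm.eqOn_divP {P : PhForm} (h : IsDecayForm Q P) (hQ : IsOpen Q) :
    EqOn (divP (momQ P)) (fun z => ∑ i, fderiv ℝ P z (0, stdE i) (stdE i, 0)) (phase Q) :=
  fun _ hz => divP_momQ (h.differentiableAt hQ hz)

theorem IsDecayForm.isDensity_divQ {P : PhForm} (h : IsDecayForm Q P) (hQ : IsOpen Q) :
    IsDensity Q (divQ (momP P)) :=
  ⟨(ContDiffOn.sum fun _ _ => h.contDiffOn_fderiv_apply hQ _ _).congr (h.eqOn_divQ hQ),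
    (FibreDominated.sum _ fun _ _ => h.fibreDominated_fderiv_apply _ _).congr (h.eqOn_divQ hQ)⟩

theorem IsDecayForm.isDensity_divP {P : PhForm} (h : IsDecayForm Q P) (hQ : IsOpen Q) :
    IsDensity Q (divP (momQ P)) :=
  ⟨(ContDiffOn.sum fun _ _ => h.contDiffOn_fderiv_apply hQ _ _).congr (h.eqOn_divP hQ),
    (FibreDominated.sum _ fun _ _ => h.fibreDominated_fderiv_apply _ _).congr (h.eqOn_divP hQ)⟩

theorem IsDecayForm.isDensity_density {P : PhForm} (h : IsDecayForm Q P) (hQ : IsOpen Q) :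
    IsDensity Q (density P) := by
  have e : density P = fun z => divP (momQ P) z + -divQ (momP P) z := by
    ext z; rw [density_eq, sub_eq_add_neg]
  rw [e]
  exact ⟨(h.isDensity_divP hQ).1.add (h.isDensity_divQ hQ).1.neg,
    (h.isDensity_divP hQ).2.add (h.isDensity_divQ hQ).2.neg⟩

theorem IsDensity.integrable {f : Ph → ℝ} (h : IsDensity Q f) {q : E3} (hq : q ∈ Q) :
    Integrable fun p => f (q, p) :=
  h.2.integrable_fibre h.1.continuousOn hq

theorem IsDensity.const_mul {f : Ph → ℝ} (h : IsDensity Q f) (c : ℝ) :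
    IsDensity Q fun z => c * f z :=
  ⟨contDiffOn_const.mul h.1, h.2.const_smul c⟩

/-- Each summand is a momentum derivative of a function that is integrable on the fibre along with
that derivative, so no boundary term at infinity survives. -/
theorem IsDecayForm.integral_divP {P : PhForm} (h : IsDecayForm Q P) (hQ : IsOpen Q) {q : E3}
    (hq : q ∈ Q) : ∫ p, divP (momQ P) (q, p) = 0 := by
  have hz : ∀ p, (q, p) ∈ phase Q := fun p => mem_phase.2 hq
  have hi : ∀ u v, Integrable fun p => fderiv ℝ P (q, p) u v := fun u v =>
    (h.fibreDominated_fderiv_apply u v).integrable_fibre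
      (h.contDiffOn_fderiv_apply hQ u v).continuousOn hq
  simp only [h.eqOn_divP hQ (hz _)]
  rw [integral_finsetSum _ fun i _ => hi _ _]
  refine Finset.sum_eq_zero fun i _ => ?_
  have hd : ∀ p, HasFDerivAt (fun p => P (q, p) (stdE i, 0))
      ((ContinuousLinearMap.apply ℝ ℝ ((stdE i, 0) : Ph)) ∘L
        (fderiv ℝ P (q, p) ∘L ContinuousLinearMap.inr ℝ E3 E3)) p := fun p =>
    (ContinuousLinearMap.apply ℝ ℝ ((stdE i, 0) : Ph)).hasFDerivAt.comp p
      ((h.differentiableAt hQ (hz p)).hasFDerivAt.comp p (hasFDerivAt_prodMk_right q p))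
  have he : ∀ p, fderiv ℝ (fun p => P (q, p) (stdE i, 0)) p (stdE i) =
      fderiv ℝ P (q, p) (0, stdE i) (stdE i, 0) := fun p => by simp [(hd p).fderiv]
  have := integral_fderiv_eq_zero (stdE i) (fun p => (hd p).differentiableAt)
    ((h.fibreDominated_apply (stdE i, 0)).integrable_fibre
      (h.1.continuousOn.clm_apply continuousOn_const) hq) (by simpa only [he] using hi _ _)
  simpa only [he] using this

theorem IsDecayForm.integral_density {P : PhForm} (h : IsDecayForm Q P) (hQ : IsOpen Q) {q : E3}
    (hq : q ∈ Q) : ∫ p, density P (q, p) = -∫ p, divQ (momP P) (q, p) := by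
  simp only [density_eq]
  rw [integral_sub ((h.isDensity_divP hQ).integrable hq) ((h.isDensity_divQ hQ).integrable hq),
    h.integral_divP hQ hq, zero_sub]

/-! ### The two pairings integrated by parts -/

theorem apply_ver (P : PhForm) (ψ : E3 → ℝ) (z : Ph) :
    P z (ver (dd ψ) z) = ∑ i, fderiv ℝ ψ z.1 (stdE i) * P z (0, stdE i) := by
  rw [ver_dd, ← inner_momP, inner_eq_sum]
  simp [gradient_apply, momP_apply, mul_comm]

theorem IsDecayForm.integrableOn_apply_ver {P : PhForm} (h : IsDecayForm Q P) (hQ : IsOpen Q)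
    {ψ : E3 → ℝ} (hψ : IsTest Q ψ) : IntegrableOn (fun z => P z (ver (dd ψ) z)) (phase Q) := by
  simp only [apply_ver]
  exact integrable_finsetSum _ fun i _ => (hψ.isCutoff_fderiv _).integrableOn_mul hQ
    (h.fibreDominated_apply _) (h.1.continuousOn.clm_apply continuousOn_const)

theorem IsDecayForm.pairT_ver {P : PhForm} (h : IsDecayForm Q P) (hQ : IsOpen Q)
    {ψ : E3 → ℝ} (hψ : IsTest Q ψ) :
    pairT Q P (ver (dd ψ)) = ∫ z in phase Q, -ψ z.1 * divQ (momP P) z := by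
  -- Evaluation at a fixed vector commutes with differentiation, so the scalar integration by parts
  -- applies to each component of `P`.
  have e : ∀ z ∈ phase Q, ∀ u v, fderiv ℝ (fun z => P z v) z u = fderiv ℝ P z u v :=
    fun z hz u v => by
      rw [show (fun z => P z v) = fun z => ContinuousLinearMap.apply ℝ ℝ v (P z) from rfl,
        fderiv_clm_comp _ (h.differentiableAt hQ hz)]
      rfl
  have hm := (isOpen_phase hQ).measurableSet
  rw [pairT]
  simp only [apply_ver]
  have hs : ∀ i, IntegrableOn (fun z : Ph => fderiv ℝ ψ z.1 (stdE i) * P z (0, stdE i))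
      (phase Q) := fun i => (hψ.isCutoff_fderiv _).integrableOn_mul hQ
    (h.fibreDominated_apply _) (h.1.continuousOn.clm_apply continuousOn_const)
  have hs' : ∀ i, IntegrableOn
      (fun z : Ph => ψ z.1 * fderiv ℝ P z (stdE i, 0) (0, stdE i)) (phase Q) := fun i =>
    hψ.isCutoff.integrableOn_mul hQ (h.fibreDominated_fderiv_apply _ _)
      (h.contDiffOn_fderiv_apply hQ _ _).continuousOn
  rw [integral_finsetSum _ fun i _ => hs i]
  have hi : ∀ i, ∫ z in phase Q, fderiv ℝ ψ z.1 (stdE i) * P z (0, stdE i) =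
      -∫ z in phase Q, ψ z.1 * fderiv ℝ P z (stdE i, 0) (0, stdE i) := fun i => by
    rw [hψ.integral_phase_fderiv_mul hQ (stdE i) (h.fibreDominated_apply _)
      ((h.fibreDominated_fderiv_apply (stdE i, 0) (0, stdE i)).congr fun z hz => e z hz _ _)
      (fun z hz => (h.differentiableAt hQ hz).clm_apply (differentiableAt_const _))
      ((h.contDiffOn_fderiv_apply hQ (stdE i, 0) (0, stdE i)).continuousOn.congr
        fun z hz => e z hz _ _)]
    congr 1
    exact setIntegral_congr_fun hm fun z hz => by simp only [e z hz]
  simp only [hi]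
  rw [Finset.sum_neg_distrib, ← integral_finsetSum _ fun i _ => hs' i,
    ← integral_neg]
  refine setIntegral_congr_fun hm fun z hz => ?_
  simp only [h.eqOn_divQ hQ hz, Finset.mul_sum, neg_mul, Finset.sum_neg_distrib]

theorem IsDensity.integrableOn_mul {f : Ph → ℝ} (h : IsDensity Q f) (hQ : IsOpen Q)
    {ψ : E3 → ℝ} (hψ : IsTest Q ψ) : IntegrableOn (fun z => -ψ z.1 * f z) (phase Q) := by
  simpa only [neg_mul, IntegrableOn] using Integrable.fun_neg (hψ.isCutoff.integrableOn_mul hQ h.2 h.1.continuousOn)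

theorem IsDensity.integral_neg_mul {f : Ph → ℝ} (h : IsDensity Q f) (hQ : IsOpen Q)
    {ψ : E3 → ℝ} (hψ : IsTest Q ψ) :
    ∫ z in phase Q, -ψ z.1 * f z = -∫ q in Q, ψ q * ∫ p, f (q, p) := by
  simp only [neg_mul, integral_neg]
  rw [hψ.isCutoff.integral_phase hQ h.2 h.1.continuousOn]

theorem IsFun.continuousOn_fderiv₂ {φ : E3 → ℝ} (h : IsFun Q φ) (hQ : IsOpen Q) (u v : E3) :
    ContinuousOn (fun q => fderiv ℝ (fderiv ℝ φ) q u v) Q := by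
  have := (ContDiffOn.fderiv_of_isOpen h hQ (m := ∞) (by simp)).fderiv_of_isOpen hQ
    (m := ∞) (by simp)
  exact (this.continuousOn.clm_apply continuousOn_const).clm_apply continuousOn_const

theorem IsFun.continuousOn_laplacian {φ : E3 → ℝ} (h : IsFun Q φ) (hQ : IsOpen Q) :
    ContinuousOn (Laplacian.laplacian φ) Q := by
  rw [show Laplacian.laplacian φ = _ from funext (laplacian_eq_sum φ)]
  exact continuousOn_finsetSum _ fun i _ => h.continuousOn_fderiv₂ hQ _ _

theorem IsFun.continuousOn_fderiv_apply {φ : E3 → ℝ} (h : IsFun Q φ) (hQ : IsOpen Q) (v : E3) :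
    ContinuousOn (fun q => fderiv ℝ φ q v) Q :=
  (ContDiffOn.fderiv_of_isOpen h hQ (m := ∞) (by simp)).continuousOn.clm_apply continuousOn_const

theorem IsFun.integrableOn_wedge {φ ψ : E3 → ℝ} (h : IsFun Q φ) (hQ : IsOpen Q)
    (hψ : IsTest Q ψ) : IntegrableOn (fun q => wedge12 (dd ψ) (star1 (dd φ)) q stdE) Q := by
  simp only [wedge12_star1, dd]
  exact (integrable_finsetSum _ fun i _ => (hψ.isCutoff_fderiv _).integrable_mul hQ
    (h.continuousOn_fderiv_apply hQ _)).integrableOn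

/-- Green's identity: the wedge is the pointwise inner product of differentials, and each coordinate
is integrated by parts. -/
theorem IsFun.pairQ_star {φ ψ : E3 → ℝ} (h : IsFun Q φ) (hQ : IsOpen Q) (hψ : IsTest Q ψ) :
    pairQ Q (star1 (dd φ)) (dd ψ) = -∫ q in Q, ψ q * Laplacian.laplacian φ q := by
  have e : ∀ q ∈ Q, ∀ u v, fderiv ℝ (fun q => fderiv ℝ φ q v) q u = fderiv ℝ (fderiv ℝ φ) q u v :=
    fun q hq u v => by
      rw [show (fun q => fderiv ℝ φ q v) =
          fun q => ContinuousLinearMap.apply ℝ ℝ v (fderiv ℝ φ q) from rfl, fderiv_clm_comp _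
        (((h.contDiffAt hQ hq).fderiv_right (m := ∞) (by simp)).differentiableAt (by simp))]
      rfl
  have hi : ∀ i, ∫ q in Q, fderiv ℝ ψ q (stdE i) * fderiv ℝ φ q (stdE i) =
      -∫ q in Q, ψ q * fderiv ℝ (fderiv ℝ φ) q (stdE i) (stdE i) := fun i => by
    rw [hψ.integral_fderiv_mul hQ (stdE i) (g := fun q => fderiv ℝ φ q (stdE i))
      (fun q hq => (((h.contDiffAt hQ hq).fderiv_right (m := ∞) (by simp)).differentiableAt
        (by simp)).clm_apply (differentiableAt_const _))
      ((h.continuousOn_fderiv₂ hQ _ _).congr fun q hq => e q hq _ _)]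
    congr 1
    exact setIntegral_congr_fun hQ.measurableSet fun q hq => by simp only [e q hq]
  simp only [pairQ, wedge12_star1, dd, laplacian_eq_sum, Finset.mul_sum]
  rw [integral_finsetSum _ fun i _ => ((hψ.isCutoff_fderiv _).integrable_mul hQ
      (h.continuousOn_fderiv_apply hQ _)).integrableOn,
    integral_finsetSum _ fun i _ => (hψ.isCutoff.integrable_mul hQ
      (h.continuousOn_fderiv₂ hQ _ _)).integrableOn]
  simp only [hi, Finset.sum_neg_distrib]

theorem IsFun.pairQ_star_eq_integ3 {φ ψ : E3 → ℝ} (h : IsFun Q φ) (hQ : IsOpen Q)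
    (hψ : IsTest Q ψ) :
    pairQ Q (star1 (dd φ)) (dd ψ) = -integ3 Q ψ (extDeriv (star1 (dd φ))) := by
  rw [h.pairQ_star hQ hψ, integ3]
  congr 1
  refine setIntegral_congr_fun hQ.measurableSet fun q hq => ?_
  simp [extDeriv_star1_dd ((h.contDiffAt hQ hq).of_le (by simpa using ENat.LEInfty.out)), vol3_stdE]

theorem pairQ_star_neg (φ ψ : E3 → ℝ) :
    pairQ Q (star1 (dd φ)) (-dd ψ) = -pairQ Q (star1 (dd φ)) (dd ψ) := by
  simp [pairQ, wedge12_star1, integral_neg]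

/-! ### Formulas and zero sets of the momentum maps -/

theorem isJP_iff {φ : E3 → ℝ} {P : PhForm} (hQ : IsOpen Q) (hφ : IsFun Q φ)
    (hP : IsDecayForm Q P) (η : Form3) : IsJP Q (star1 (dd φ)) P η ↔
      EqOn η (fun q => (Laplacian.laplacian φ q - ∫ p, divQ (momP P) (q, p)) • vol3) Q := by
  have hd := hP.isDensity_divQ hQ
  have hc := hd.2.continuousOn_integral hd.1.continuousOn hQ
  refine represents_iff hQ ((hφ.continuousOn_laplacian hQ).sub hc) (fun ψ hψ => ?_) η
  rw [pairQ_star_neg, hφ.pairQ_star hQ hψ, hP.pairT_ver hQ hψ, hd.integral_neg_mul hQ hψ, neg_neg,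
    ← sub_eq_add_neg, ← integral_sub
      (hψ.isCutoff.integrable_mul hQ (hφ.continuousOn_laplacian hQ)).integrableOn
      (hψ.isCutoff.integrable_mul hQ hc).integrableOn]
  exact integral_congr_ae (ae_of_all _ fun q => (mul_sub _ _ _).symm)

theorem isJDen_iff {φ : E3 → ℝ} {f : Ph → ℝ} (hQ : IsOpen Q) (hφ : IsFun Q φ)
    (hf : IsDensity Q f) (η : Form3) : IsJDen Q (star1 (dd φ)) f η ↔
      EqOn η (fun q => (-(Laplacian.laplacian φ q + ∫ p, f (q, p))) • vol3) Q := by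
  have hc := hf.2.continuousOn_integral hf.1.continuousOn hQ
  refine represents_iff hQ ((hφ.continuousOn_laplacian hQ).add hc).neg (fun ψ hψ => ?_) η
  have : pairD Q f (fun z => -ψ z.1) = ∫ z in phase Q, -ψ z.1 * f z := by
    simp only [pairD, mul_comm]
  rw [hφ.pairQ_star hQ hψ, this, hf.integral_neg_mul hQ hψ, ← neg_add, ← integral_add
      (hψ.isCutoff.integrable_mul hQ (hφ.continuousOn_laplacian hQ)).integrableOn
      (hψ.isCutoff.integrable_mul hQ hc).integrableOn, ← integral_neg]
  exact integral_congr_ae (ae_of_all _ fun q => by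
    simp only [Pi.neg_apply, Pi.add_apply, mul_neg, mul_add])

theorem eqOn_zero_smul_vol3 (D : E3 → ℝ) :
    EqOn (0 : Form3) (fun q => D q • vol3) Q ↔ ∀ q ∈ Q, D q = 0 := by
  refine forall₂_congr fun q _ => ⟨fun h => ?_, fun h => by simp [h]⟩
  have := congrArg (fun a : E3 [⋀^Fin 3]→L[ℝ] ℝ => a stdE) h
  simpa [vol3_stdE] using this.symm

theorem isJP_zero_iff {φ : E3 → ℝ} {P : PhForm} (hQ : IsOpen Q) (hφ : IsFun Q φ)
    (hP : IsDecayForm Q P) : IsJP Q (star1 (dd φ)) P 0 ↔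
      ∀ q ∈ Q, Laplacian.laplacian φ q = ∫ p, divQ (momP P) (q, p) := by
  rw [isJP_iff hQ hφ hP, eqOn_zero_smul_vol3]
  simp only [sub_eq_zero]

theorem isJP_smul_zero_iff {φ : E3 → ℝ} {P : PhForm} (hQ : IsOpen Q) (hφ : IsFun Q φ)
    (hP : IsDecayForm Q P) (c : ℝ) : IsJP Q (star1 (dd φ)) (c • P) 0 ↔
      ∀ q ∈ Q, Laplacian.laplacian φ q = c * ∫ p, divQ (momP P) (q, p) := by
  rw [isJP_zero_iff hQ hφ (hP.const_smul c)]
  refine forall₂_congr fun q hq => ?_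
  have hz : ∀ p, (q, p) ∈ phase Q := fun p => mem_phase.2 hq
  have e : fderiv ℝ (c • P) = c • fderiv ℝ P :=
    fderiv_const_smul_field (R := ℝ) (E := Ph) (F := Ph →L[ℝ] ℝ) (f := P) c
  simp only [(hP.const_smul c).eqOn_divQ hQ (hz _), hP.eqOn_divQ hQ (hz _), e,
    ← integral_const_mul, Finset.mul_sum, FunLike.coe_smul, Pi.smul_apply, smul_eq_mul]

theorem isJP_smul_zero_iff_poissonEq {φ : E3 → ℝ} {P : PhForm} (hQ : IsOpen Q) (hφ : IsFun Q φ)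
    (hP : IsDecayForm Q P) (c : ℝ) :
    IsJP Q (star1 (dd φ)) (c • P) 0 ↔ PoissonEq Q c φ (density P) := by
  rw [isJP_smul_zero_iff hQ hφ hP]
  refine forall₂_congr fun q hq => ?_
  rw [hP.integral_density hQ hq, neg_mul_neg]

theorem isJDen_mul_iff {φ : E3 → ℝ} {f : Ph → ℝ} (hQ : IsOpen Q) (hφ : IsFun Q φ)
    (hf : IsDensity Q f) (c : ℝ) (η : Form3) :
    IsJDen Q (star1 (dd φ)) (fun z => c * f z) η ↔
      EqOn η (fun q => (-(Laplacian.laplacian φ q + c * ∫ p, f (q, p))) • vol3) Q := by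
  rw [isJDen_iff hQ hφ (hf.const_mul c)]
  simp only [integral_const_mul]

theorem isJDen_zero_iff_poissonEq {φ : E3 → ℝ} {f : Ph → ℝ} (hQ : IsOpen Q) (hφ : IsFun Q φ)
    (hf : IsDensity Q f) (c : ℝ) :
    IsJDen Q (star1 (dd φ)) (fun z => c * f z) 0 ↔ PoissonEq Q c φ f := by
  rw [isJDen_mul_iff hQ hφ hf, eqOn_zero_smul_vol3]
  simp only [PoissonEq, neg_eq_zero, neg_mul, add_eq_zero_iff_eq_neg]

/-! ### Infinitesimal gauge action and Lie–Poisson brackets -/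

/-- All dependence on `s` sits in `Y`, which vanishes off one compact `K` for |s| < 1, so a constant
times the indicator of `K` dominates the derivative. The general target `E` covers both one-forms
and scalar densities. -/
theorem hasDerivAt_setIntegral_clm_apply {E : Type*} [NormedAddCommGroup E] [NormedSpace ℝ E]
    {U K : Set Ph} (hU : IsOpen U) (hK : IsCompact K) (hKU : K ⊆ U) {P : Ph → E →L[ℝ] ℝ}
    (hP : ContinuousOn P U) {Y : ℝ × Ph → E} (hY : ContDiff ℝ 1 Y)
    (h0 : ∀ s ∈ Ioo (-1 : ℝ) 1, ∀ w ∉ K, Y (s, w) = 0) {Y' : Ph → E}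
    (hY' : ∀ w, HasDerivAt (fun s => Y (s, w)) (Y' w) 0) :
    HasDerivAt (fun s => ∫ w in U, P w (Y (s, w))) (∫ w in U, P w (Y' w)) 0 := by
  have hd : ∀ s w, HasDerivAt (fun s => Y (s, w)) (fderiv ℝ Y (s, w) (1, 0)) s := fun s w =>
    (hY.differentiable one_ne_zero (s, w)).hasFDerivAt.comp_hasDerivAt s
      ((hasDerivAt_id s).prodMk (hasDerivAt_const s w))
  -- Off `K`, `Y` vanishes for all nearby `s`, hence so does its derivative in `s`.
  have hd0 : ∀ s ∈ Ioo (-1 : ℝ) 1, ∀ w ∉ K, fderiv ℝ Y (s, w) (1, 0) = 0 := fun s hs w hw =>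
    (hd s w).unique ((hasDerivAt_const s (0 : E)).congr_of_eventuallyEq (by
      filter_upwards [isOpen_Ioo.mem_nhds hs] with r hr using h0 r hr w hw))
  have hcd : Continuous fun x : ℝ × Ph => fderiv ℝ Y x (1, 0) :=
    (hY.continuous_fderiv one_ne_zero).clm_apply continuous_const
  have hcY : ContinuousOn (fun x : ℝ × Ph => P x.2 (Y x)) (Icc (-1 : ℝ) 1 ×ˢ K) :=
    (hP.comp continuousOn_snd fun x hx => hKU hx.2).clm_apply hY.continuous.continuousOn
  have hcY' : ContinuousOn (fun x : ℝ × Ph => P x.2 (fderiv ℝ Y x (1, 0)))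
      (Icc (-1 : ℝ) 1 ×ˢ K) :=
    (hP.comp continuousOn_snd fun x hx => hKU hx.2).clm_apply hcd.continuousOn
  obtain ⟨C, hC⟩ := (isCompact_Icc.prod hK).exists_bound_of_continuousOn hcY
  obtain ⟨C', hC'⟩ := (isCompact_Icc.prod hK).exists_bound_of_continuousOn hcY'
  have hind : ∀ c : ℝ, Integrable (K.indicator fun _ => c) (volume.restrict U) := fun c =>
    ((integrableOn_const hK.measure_lt_top.ne).integrable_indicator hK.measurableSet).integrableOn
  have hm : ∀ s, AEStronglyMeasurable (fun w => P w (Y (s, w))) (volume.restrict U) := fun s =>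
    (hP.clm_apply (hY.continuous.comp (by fun_prop)).continuousOn).aestronglyMeasurable
      hU.measurableSet
  have hzero : (0 : ℝ) ∈ Ioo (-1 : ℝ) 1 := by simp
  have key := (hasDerivAt_integral_of_dominated_loc_of_deriv_le (μ := volume.restrict U)
    (F := fun s w => P w (Y (s, w))) (F' := fun s w => P w (fderiv ℝ Y (s, w) (1, 0)))
    (bound := K.indicator fun _ => C') (isOpen_Ioo.mem_nhds hzero)
    (Filter.Eventually.of_forall hm)
    ((hind C).mono' (hm 0) (Filter.Eventually.of_forall fun w => ?_)) ?_
    (Filter.Eventually.of_forall fun w s hs => ?_) (hind C')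
    (Filter.Eventually.of_forall fun w s _ => (P w).hasFDerivAt.comp_hasDerivAt s (hd s w))).2
  · rwa [show Y' = fun w => fderiv ℝ Y (0, w) (1, 0) from funext fun w => (hY' w).unique (hd 0 w)]
  · by_cases hw : w ∈ K
    · simpa [hw] using hC (0, w) ⟨by simp, hw⟩
    · simp [hw, h0 0 hzero w hw]
  · exact (hP.clm_apply (hcd.comp (by fun_prop)).continuousOn).aestronglyMeasurable
      hU.measurableSet
  · by_cases hw : w ∈ K
    · simpa [hw] using hC' (s, w) ⟨Ioo_subset_Icc_self hs, hw⟩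
    · simp [hw, hd0 s hs w hw]

/-- The shear `(q, p) ↦ (q, p + g q)`. -/
def shear (g : E3 → E3) (hg : Continuous g) : Ph ≃ₜ Ph where
  toFun z := (z.1, z.2 + g z.1)
  invFun z := (z.1, z.2 - g z.1)
  left_inv z := by simp
  right_inv z := by simp
  continuous_toFun := by fun_prop
  continuous_invFun := by fun_prop

/-- For fixed `q` the shear is a translation in `p`, so it is a skew product of measure-preserving
maps. -/
theorem measurePreserving_shear (g : E3 → E3) (hg : Continuous g) :
    MeasurePreserving (shear g hg) := by
  rw [Measure.volume_eq_prod]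
  exact (MeasurePreserving.id (volume : Measure E3)).skew_product
    (g := fun q p => p + g q) (by fun_prop)
    (Filter.Eventually.of_forall fun q => (measurePreserving_add_right volume (g q)).map_eq)

theorem setIntegral_shear (g : E3 → E3) (hg : Continuous g) (G : Ph → ℝ) :
    ∫ z in phase Q, G z = ∫ z in phase Q, G (z.1, z.2 + g z.1) :=
  ((measurePreserving_shear g hg).setIntegral_preimage_emb
    (shear g hg).measurableEmbedding G (phase Q)).symm

theorem fibreShift_shear (ψ : E3 → ℝ) (s : ℝ) (z : Ph) :
    fibreShift (s • ψ) (z.1, z.2 + s • ∇ ψ z.1) = z := by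
  simp [fibreShift, gradient_smul]

theorem contDiff_gradient {ψ : E3 → ℝ} (h : ContDiff ℝ ∞ ψ) : ContDiff ℝ ∞ (∇ ψ) :=
  contDiff_iff_contDiffAt.2 fun _ => contDiffAt_gradient h.contDiffAt

/-- `K'` is swept out by the inverse shears of `K` with |s| ≤ 1; it stays over `Q` because shears
fix `q`. -/
theorem exists_compact_shear {K : Set Ph} (hK : IsCompact K) (hKQ : K ⊆ phase Q) {g : E3 → E3}
    (hg : Continuous g) : ∃ K' ⊆ phase Q, IsCompact K' ∧
      ∀ s ∈ Ioo (-1 : ℝ) 1, ∀ w ∉ K', ((w.1, w.2 + s • g w.1) : Ph) ∉ K := by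
  refine ⟨(fun x : ℝ × Ph => ((x.2.1, x.2.2 - x.1 • g x.2.1) : Ph)) '' (Icc (-1) 1 ×ˢ K), ?_,
    (isCompact_Icc.prod hK).image (by fun_prop), fun s hs w hw h => hw ?_⟩
  · rintro _ ⟨x, hx, rfl⟩
    exact mem_phase.2 (mem_phase.1 (hKQ hx.2) : x.2.1 ∈ Q)
  · exact ⟨(s, (w.1, w.2 + s • g w.1)), ⟨Ioo_subset_Icc_self hs, h⟩, by simp⟩

theorem hasDerivAt_comp_shear {E : Type*} [NormedAddCommGroup E] [NormedSpace ℝ E] {X : Ph → E}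
    (hX : Differentiable ℝ X) (z : Ph) (v : E3) :
    HasDerivAt (fun s : ℝ => X (z.1, z.2 + s • v)) (fderiv ℝ X z (0, v)) 0 := by
  have h1 : HasDerivAt (fun s : ℝ => ((z.1, z.2 + s • v) : Ph)) (0, v) 0 :=
    (hasDerivAt_const _ _).prodMk (by simpa using ((hasDerivAt_id (0 : ℝ)).smul_const v).const_add z.2)
  have h2 : HasFDerivAt X (fderiv ℝ X z) (z.1, z.2 + (0 : ℝ) • v) := by
    simpa using (hX z).hasFDerivAt
  exact h2.comp_hasDerivAt 0 h1

/-- The shear inverse to the gauge translation is substituted in the integral. Then `P` no longer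
depends on `s`, and only the pushed-forward field has to be differentiated. -/
theorem pairT_gaugePull {ψ : E3 → ℝ} (hψ : ContDiff ℝ ∞ ψ) (P : PhForm) (X : Ph → Ph) (s : ℝ) :
    pairT Q (gaugePull (s • ψ) P) X = ∫ w in phase Q, P w ((X (w.1, w.2 + s • ∇ ψ w.1)).1,
      (X (w.1, w.2 + s • ∇ ψ w.1)).2 -
        s • fderiv ℝ (∇ ψ) w.1 (X (w.1, w.2 + s • ∇ ψ w.1)).1) := by
  have hg := contDiff_gradient hψ
  have hs : ∇ (s • ψ) = s • ∇ ψ := funext fun q => gradient_smul ψ s q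
  have hd : ∀ q, DifferentiableAt ℝ (∇ (s • ψ)) q := fun q => by
    rw [hs]; exact (hg.differentiable (by simp) q).const_smul s
  rw [pairT, setIntegral_shear (fun q => s • ∇ ψ q) (hg.continuous.const_smul s)]
  congr 1 with w
  simp only [gaugePull, fibreShift_shear, ContinuousLinearMap.comp_apply]
  rw [fderiv_fibreShift (hd _), hs, fderiv_const_smul (hg.differentiable (by simp) w.1)]
  rfl

theorem hasDerivAt_pairT_gaugePull {ψ : E3 → ℝ} (hψ : IsTest Q ψ) (hQ : IsOpen Q) {P : PhForm}
    (hP : ContinuousOn P (phase Q)) {X : Ph → Ph} (hX : ContDiff ℝ ∞ X)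
    (hXc : HasCompactSupport X) (hXQ : tsupport X ⊆ phase Q) :
    HasDerivAt (fun s : ℝ => pairT Q (gaugePull (s • ψ) P) X)
      (lpBracket Q P X (ver (dd ψ))) 0 := by
  have hg := contDiff_gradient hψ.1
  have hg' : ContDiff ℝ ∞ (fderiv ℝ (∇ ψ)) := hg.fderiv_right (by simp)
  obtain ⟨K', hK'Q, hK', hK0⟩ := exists_compact_shear hXc hXQ hg.continuous
  have hT : ContDiff ℝ ∞ fun x : ℝ × Ph => X (x.2.1, x.2.2 + x.1 • ∇ ψ x.2.1) :=
    hX.comp (by fun_prop)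
  have hY : ContDiff ℝ ∞ fun x : ℝ × Ph => (((X (x.2.1, x.2.2 + x.1 • ∇ ψ x.2.1)).1,
      (X (x.2.1, x.2.2 + x.1 • ∇ ψ x.2.1)).2 -
        x.1 • fderiv ℝ (∇ ψ) x.2.1 (X (x.2.1, x.2.2 + x.1 • ∇ ψ x.2.1)).1) : Ph) :=
    hT.fst.prodMk (hT.snd.sub (contDiff_fst.smul ((hg'.comp (by fun_prop)).clm_apply hT.fst)))
  have key := hasDerivAt_setIntegral_clm_apply (isOpen_phase hQ) hK' hK'Q hP
    (hY.of_le (by simp)) (fun s hs w hw => by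
      simp [image_eq_zero_of_notMem_tsupport (hK0 s hs w hw)])
    (Y' := fun w => -VectorField.lieBracket ℝ X (ver (dd ψ)) w) fun w => by
      have h1 := hasDerivAt_comp_shear (hX.differentiable (by simp)) w (∇ ψ w.1)
      have h2 : HasDerivAt (fun s : ℝ => (X (w.1, w.2 + s • ∇ ψ w.1)).1)
          (fderiv ℝ X w (0, ∇ ψ w.1)).1 0 :=
        (ContinuousLinearMap.fst ℝ E3 E3).hasFDerivAt.comp_hasDerivAt 0 h1
      have h3 : HasDerivAt (fun s : ℝ => (X (w.1, w.2 + s • ∇ ψ w.1)).2)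
          (fderiv ℝ X w (0, ∇ ψ w.1)).2 0 :=
        (ContinuousLinearMap.snd ℝ E3 E3).hasFDerivAt.comp_hasDerivAt 0 h1
      have h4 := (hasDerivAt_id (0 : ℝ)).fun_smul
        ((fderiv ℝ (∇ ψ) w.1).hasFDerivAt.comp_hasDerivAt 0 h2)
      -- The derivative is DX(0, ∇ψ) - (0, H X.1) with `H` the Hessian of `ψ`, which is minus the
      -- Jacobi–Lie bracket of `X` and ver(dψ).
      refine HasDerivAt.congr_deriv (h2.prodMk (h3.sub h4)) ?_
      rw [VectorField.lieBracket, fderiv_ver (hg.differentiable (by simp) w.1), ver_dd]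
      ext1 <;> simp
  rwa [funext (pairT_gaugePull hψ.1 P X)]

theorem gradP_inner {k : Ph → ℝ} {z : Ph} (h : DifferentiableAt ℝ k z) (v : E3) :
    ⟪gradP k z, v⟫ = fderiv ℝ k z (0, v) := by
  have : HasFDerivAt (fun p => k (z.1, p)) (fderiv ℝ k z ∘L ContinuousLinearMap.inr ℝ E3 E3) z.2 :=
    h.hasFDerivAt.comp z.2 (hasFDerivAt_prodMk_right z.1 z.2)
  rw [gradP, inner_gradient_left, this.fderiv]; rfl

theorem gradQ_inner {k : Ph → ℝ} {z : Ph} (h : DifferentiableAt ℝ k z) (v : E3) :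
    ⟪gradQ k z, v⟫ = fderiv ℝ k z (v, 0) := by
  have : HasFDerivAt (fun q => k (q, z.2)) (fderiv ℝ k z ∘L ContinuousLinearMap.inl ℝ E3 E3) z.1 :=
    h.hasFDerivAt.comp z.1 (hasFDerivAt_prodMk_left z.1 z.2)
  rw [gradQ, inner_gradient_left, this.fderiv]; rfl

theorem poisson_neg {k : Ph → ℝ} {z : Ph} (h : DifferentiableAt ℝ k z) (ψ : E3 → ℝ) :
    poisson k (fun z => -ψ z.1) z = fderiv ℝ k z (0, ∇ ψ z.1) := by
  have h1 : gradP (fun z => -ψ z.1) z = 0 := gradient_fun_const z.2 (-ψ z.1)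
  have h2 : gradQ (fun z => -ψ z.1) z = -∇ ψ z.1 := by
    simp only [gradQ, gradient_eq, fderiv_fun_neg, map_neg]
  rw [poisson, h1, h2, inner_zero_right, inner_neg_right, gradP_inner h]
  ring

theorem hasDerivAt_pairD_fibreShift {ψ : E3 → ℝ} (hψ : IsTest Q ψ) (hQ : IsOpen Q) {f : Ph → ℝ}
    (hf : ContinuousOn f (phase Q)) {k : Ph → ℝ} (hk : ContDiff ℝ ∞ k)
    (hkc : HasCompactSupport k) (hkQ : tsupport k ⊆ phase Q) :
    HasDerivAt (fun s : ℝ => pairD Q (fun z => f (fibreShift (s • ψ) z)) k)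
      (lpBracketDen Q f k fun z => -ψ z.1) 0 := by
  have hg := contDiff_gradient hψ.1
  obtain ⟨K', hK'Q, hK', hK0⟩ := exists_compact_shear hkc hkQ hg.continuous
  have hY : ContDiff ℝ ∞ fun x : ℝ × Ph => k (x.2.1, x.2.2 + x.1 • ∇ ψ x.2.1) :=
    hk.comp (by fun_prop)
  have key := hasDerivAt_setIntegral_clm_apply (isOpen_phase hQ) hK' hK'Q
    (P := fun w => f w • ContinuousLinearMap.id ℝ ℝ) (hf.smul continuousOn_const)
    (hY.of_le (by simp)) (fun s hs w hw => image_eq_zero_of_notMem_tsupport (hK0 s hs w hw))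
    fun w => hasDerivAt_comp_shear (hk.differentiable (by simp)) w (∇ ψ w.1)
  have e : ∀ s : ℝ, pairD Q (fun z => f (fibreShift (s • ψ) z)) k =
      ∫ w in phase Q, f w * k (w.1, w.2 + s • ∇ ψ w.1) := fun s => by
    rw [pairD, setIntegral_shear (fun q => s • ∇ ψ q) (hg.continuous.const_smul s)]
    simp only [fibreShift_shear]
  rw [funext e]
  simpa [lpBracketDen, pairD, poisson_neg (hk.differentiable (by simp) _)] using key

/-! ### From momentum-Vlasov to Vlasov -/

/-- Time and space derivatives of a jointly smooth family commute. -/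
theorem hasDerivAt_fderiv_slice {V : Type*} [NormedAddCommGroup V] [NormedSpace ℝ V]
    {G : ℝ × Ph → V} {t : ℝ} {z : Ph} (hG : ContDiffAt ℝ ∞ G (t, z)) (u : Ph) :
    HasDerivAt (fun s => fderiv ℝ (fun y => G (s, y)) z u)
      (fderiv ℝ (fun y => fderiv ℝ G (t, y) (1, 0)) z u) t := by
  have hev : ∀ᶠ x in nhds (t, z), DifferentiableAt ℝ G x :=
    ((hG.of_le (show ((1 : ℕ) : WithTop ℕ∞) ≤ ∞ by simp)).eventually (by simp)).mono
      fun x hx => hx.differentiableAt (by simp)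
  have hd : DifferentiableAt ℝ (fderiv ℝ G) (t, z) :=
    (hG.fderiv_right (m := ∞) (by simp)).differentiableAt (by simp)
  -- Near `t` the slice derivative is the full derivative in direction (0, u), so the claim becomes
  -- symmetry of the second derivative in (1, 0) and (0, u).
  have hslice : (fun s => fderiv ℝ (fun y => G (s, y)) z u) =ᶠ[nhds t]
      fun s => fderiv ℝ G (s, z) (0, u) := by
    have hc : ContinuousAt (fun s : ℝ => (s, z)) t := by fun_prop
    filter_upwards [hc.eventually hev] with s hs
    have := hs.hasFDerivAt.comp z (hasFDerivAt_prodMk_right s z)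
    rw [show fderiv ℝ (fun y => G (s, y)) z = _ from this.fderiv]
    simp
  have h1 : HasDerivAt (fun s => fderiv ℝ G (s, z) (0, u))
      (fderiv ℝ (fderiv ℝ G) (t, z) (1, 0) (0, u)) t :=
    (ContinuousLinearMap.apply ℝ V ((0, u) : ℝ × Ph)).hasFDerivAt.comp_hasDerivAt t
      (hd.hasFDerivAt.comp_hasDerivAt t ((hasDerivAt_id t).prodMk (hasDerivAt_const t z)))
  have h2 : HasFDerivAt (fun y => fderiv ℝ G (t, y) (1, 0))
      ((ContinuousLinearMap.apply ℝ V ((1, 0) : ℝ × Ph)) ∘L (fderiv ℝ (fderiv ℝ G) (t, z) ∘L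
        ContinuousLinearMap.inr ℝ ℝ Ph)) z :=
    (ContinuousLinearMap.apply ℝ V ((1, 0) : ℝ × Ph)).hasFDerivAt.comp z
      (hd.hasFDerivAt.comp z (hasFDerivAt_prodMk_right t z))
  rw [h2.fderiv]
  refine (h1.congr_of_eventuallyEq hslice).congr_deriv ?_
  simpa using (hG.isSymmSndFDerivAt (by simpa using ENat.LEInfty.out)).eq (1, 0) (0, u)

theorem density_eq_sum {P : PhForm} {z : Ph} (h : DifferentiableAt ℝ P z) :
    density P z = ∑ i, (fderiv ℝ P z (0, stdE i) (stdE i, 0) -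
      fderiv ℝ P z (stdE i, 0) (0, stdE i)) := by
  rw [density_eq, divP_momQ h, divQ_momP h, Finset.sum_sub_distrib]

theorem hasDerivAt_density {I : Set ℝ} (hI : IsOpen I) (hQ : IsOpen Q) {P : ℝ → PhForm}
    (hP : ContDiffOn ℝ ∞ (fun y : ℝ × Ph => P y.1 y.2) (I ×ˢ phase Q)) {t : ℝ} (ht : t ∈ I)
    {z : Ph} (hz : z ∈ phase Q) :
    HasDerivAt (fun s => density (P s) z)
      (density (fun y => fderiv ℝ (fun x : ℝ × Ph => P x.1 x.2) (t, y) (1, 0)) z) t := by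
  set G : ℝ × Ph → Ph →L[ℝ] ℝ := fun x => P x.1 x.2 with hGdef
  have hG : ∀ s ∈ I, ContDiffAt ℝ ∞ G (s, z) := fun s hs =>
    hP.contDiffAt ((hI.prod (isOpen_phase hQ)).mem_nhds ⟨hs, hz⟩)
  have hB : DifferentiableAt ℝ (fun y => fderiv ℝ G (t, y) (1, 0)) z :=
    DifferentiableAt.clm_apply (DifferentiableAt.comp z
      ((((hG t ht).fderiv_right (m := ∞) (by simp)).differentiableAt (by simp)) :
        DifferentiableAt ℝ (fderiv ℝ G) (t, z)) (by fun_prop)) (differentiableAt_const _)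
  have hev : (fun s => density (P s) z) =ᶠ[nhds t] fun s =>
      ∑ i, (fderiv ℝ (fun y => G (s, y)) z (0, stdE i) (stdE i, 0) -
        fderiv ℝ (fun y => G (s, y)) z (stdE i, 0) (0, stdE i)) := by
    filter_upwards [hI.mem_nhds ht] with s hs
    exact density_eq_sum (P := fun y => G (s, y))
      (DifferentiableAt.comp z ((hG s hs).differentiableAt (by simp)) (by fun_prop))
  rw [density_eq_sum hB]
  have hap : ∀ u v, HasDerivAt (fun s => fderiv ℝ (fun y => G (s, y)) z u v)
      (fderiv ℝ (fun y => fderiv ℝ G (t, y) (1, 0)) z u v) t := fun u v =>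
    (ContinuousLinearMap.apply ℝ ℝ v).hasFDerivAt.comp_hasDerivAt t
      (hasDerivAt_fderiv_slice (hG t ht) u)
  exact (HasDerivAt.fun_sum fun i _ => (hap _ _).sub (hap _ _)).congr_of_eventuallyEq hev

theorem hamField_energy {m c : ℝ} (hm : 0 < m) {φ : E3 → ℝ} {z : Ph} :
    hamField (energy m c φ) z = ((1 / m) • z.2, -(c • ∇ φ z.1)) := by
  have h1 : gradP (energy m c φ) z = (1 / m) • z.2 := by
    have e : (fun p => energy m c φ (z.1, p)) = fun p => (2 * m)⁻¹ * ‖p‖ ^ 2 + c * φ z.1 := by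
      ext p; rw [energy, div_eq_inv_mul]
    have := ((hasStrictFDerivAt_norm_sq z.2).hasFDerivAt.const_mul (2 * m)⁻¹).add_const (c * φ z.1)
    refine ext_inner_right ℝ fun v => ?_
    rw [gradP, inner_gradient_left, e, this.fderiv]
    simp [inner_smul_left]
    field_simp
  have h2 : gradQ (energy m c φ) z = c • ∇ φ z.1 := by
    rw [← gradient_smul]
    simp only [gradQ, gradient_eq]
    congr 1
    exact fderiv_const_add (f := c • φ) (‖z.2‖ ^ 2 / (2 * m))
  rw [hamField, h1, h2]

/-- Cyclicity of the trace. -/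
theorem sum_apply_comp_comm (H L : E3 →L[ℝ] E3) :
    ∑ i, H (L (stdE i)) i = ∑ i, L (H (stdE i)) i := by
  have key : ∀ A B : E3 →L[ℝ] E3, ∑ i, A (B (stdE i)) i =
      ∑ i, ∑ j, B (stdE i) j * A (stdE j) i := fun A B => by
    refine Finset.sum_congr rfl fun i _ => ?_
    rw [map_eq_sum_stdE A]
    simp
  rw [key, key, Finset.sum_comm]
  simp only [mul_comm]

theorem fderiv_fderiv_apply_vectorField {V : Type*} [NormedAddCommGroup V] [NormedSpace ℝ V]
    {A : Ph → V} {X : Ph → Ph} {z : Ph} (hA : ContDiffAt ℝ ∞ A z) (hX : DifferentiableAt ℝ X z)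
    (u : Ph) : fderiv ℝ (fun y => fderiv ℝ A y (X y)) z u =
      fderiv ℝ (fderiv ℝ A) z (X z) u + fderiv ℝ A z (fderiv ℝ X z u) := by
  have hd : DifferentiableAt ℝ (fderiv ℝ A) z :=
    (hA.fderiv_right (m := ∞) (by simp)).differentiableAt (by simp)
  rw [(hd.hasFDerivAt.clm_apply hX.hasFDerivAt).fderiv,
    (hA.isSymmSndFDerivAt (by simpa using ENat.LEInfty.out)).eq]
  simp [add_comm]

theorem apply_fderiv_apply {V W : Type*} [NormedAddCommGroup V] [NormedSpace ℝ V]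
    [NormedAddCommGroup W] [NormedSpace ℝ W] {A : Ph → V} {z : Ph} (hA : ContDiffAt ℝ ∞ A z)
    (L : V →L[ℝ] W) (u v : Ph) :
    fderiv ℝ (fun y => L (fderiv ℝ A y u)) z v = L (fderiv ℝ (fderiv ℝ A) z v u) := by
  have hd : DifferentiableAt ℝ (fderiv ℝ A) z :=
    (hA.fderiv_right (m := ∞) (by simp)).differentiableAt (by simp)
  rw [show fderiv ℝ (fun y => L (fderiv ℝ A y u)) z = _ from (L.hasFDerivAt.comp z
    ((ContinuousLinearMap.apply ℝ V u).hasFDerivAt.comp z hd.hasFDerivAt)).fderiv]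
  rfl

/-- The transport identity behind the Vlasov equation: the fields on the right-hand side of the
momentum-Vlasov equations have divergence minus the derivative of the density along `X`. -/
theorem divP_sub_divQ_momentumVlasov {m c : ℝ} {φ : E3 → ℝ} {Aq Ap : Ph → E3} {z : Ph}
    (hφ : ContDiffAt ℝ ∞ φ z.1) (hq : ContDiffAt ℝ ∞ Aq z) (hp : ContDiffAt ℝ ∞ Ap z)
    {X : Ph → Ph} (hX : X = fun y => ((1 / m) • y.2, -(c • ∇ φ y.1))) :
    divP (fun y => -(fderiv ℝ Aq y (X y)) + c • fderiv ℝ (∇ φ) y.1 (Ap y)) z -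
      divQ (fun y => -(fderiv ℝ Ap y (X y)) - (1 / m) • Aq y) z =
        -fderiv ℝ (fun y => divP Aq y - divQ Ap y) z (X z) := by
  have hg : ContDiffAt ℝ ∞ (∇ φ) z.1 := contDiffAt_gradient hφ
  have hgd : DifferentiableAt ℝ (∇ φ) z.1 := hg.differentiableAt (by simp)
  have hH : DifferentiableAt ℝ (fderiv ℝ (∇ φ)) z.1 :=
    (hg.fderiv_right (m := ∞) (by simp)).differentiableAt (by simp)
  have hqd : DifferentiableAt ℝ Aq z := hq.differentiableAt (by simp)
  have hpd : DifferentiableAt ℝ Ap z := hp.differentiableAt (by simp)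
  have hXd : HasFDerivAt X (((1 / m) • ContinuousLinearMap.snd ℝ E3 E3).prod
      (-(c • (fderiv ℝ (∇ φ) z.1 ∘L ContinuousLinearMap.fst ℝ E3 E3)))) z := by
    rw [hX]
    exact (hasFDerivAt_snd.const_smul (1 / m)).prodMk
      (((hgd.hasFDerivAt.comp z hasFDerivAt_fst).const_smul c).neg)
  have hfd : ∀ {A : Ph → E3}, ContDiffAt ℝ ∞ A z →
      DifferentiableAt ℝ (fun y => fderiv ℝ A y (X y)) z := fun hA =>
    ((hA.fderiv_right (m := ∞) (by simp)).differentiableAt (by simp)).clm_apply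
      hXd.differentiableAt
  have hHA : HasFDerivAt (fun y : Ph => fderiv ℝ (∇ φ) y.1 (Ap y)) _ z :=
    (hH.hasFDerivAt.comp z hasFDerivAt_fst).clm_apply hpd.hasFDerivAt
  -- The field has DX(0, w) = (w/m, 0) and DX(w, 0) = (0, -c Hw), where `H` is the Hessian of `φ`.
  have hX1 : ∀ (L : Ph →L[ℝ] E3) w, L (fderiv ℝ X z (0, w)) = (1 / m) • L (w, 0) := fun L w => by
    rw [← map_smul]; simp [hXd.fderiv]
  have hX2 : ∀ (L : Ph →L[ℝ] E3) w,
      L (fderiv ℝ X z (w, 0)) = -(c • L (0, fderiv ℝ (∇ φ) z.1 w)) := fun L w => by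
    rw [← map_smul, ← map_neg]; simp [hXd.fderiv]
  have e1 : ∀ i, fderiv ℝ (fun y => -(fderiv ℝ Aq y (X y)) + c • fderiv ℝ (∇ φ) y.1 (Ap y)) z
      (0, stdE i) = -(fderiv ℝ (fderiv ℝ Aq) z (X z) (0, stdE i) +
        (1 / m) • fderiv ℝ Aq z (stdE i, 0)) +
        c • fderiv ℝ (∇ φ) z.1 (fderiv ℝ Ap z (0, stdE i)) := fun i => by
    rw [((hfd hq).hasFDerivAt.fun_neg.fun_add (hHA.fun_const_smul c)).fderiv]
    simp [fderiv_fderiv_apply_vectorField hq hXd.differentiableAt, hX1]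
  have e2 : ∀ i, fderiv ℝ (fun y => -(fderiv ℝ Ap y (X y)) - (1 / m) • Aq y) z (stdE i, 0) =
      -(fderiv ℝ (fderiv ℝ Ap) z (X z) (stdE i, 0) -
        c • fderiv ℝ Ap z (0, fderiv ℝ (∇ φ) z.1 (stdE i))) -
        (1 / m) • fderiv ℝ Aq z (stdE i, 0) := fun i => by
    rw [((hfd hp).hasFDerivAt.fun_neg.fun_sub (hqd.hasFDerivAt.fun_const_smul (1 / m))).fderiv]
    simp [fderiv_fderiv_apply_vectorField hp hXd.differentiableAt, hX2, sub_eq_add_neg]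
  have d1 : ∀ (A : Ph → E3) (_ : ContDiffAt ℝ ∞ A z) (w : Fin 3 → Ph),
      HasFDerivAt (fun y => ∑ i, fderiv ℝ A y (w i) i)
        (∑ i, fderiv ℝ (fun y => fderiv ℝ A y (w i) i) z) z := fun A hA w =>
    HasFDerivAt.fun_sum fun i _ => DifferentiableAt.hasFDerivAt
      ((EuclideanSpace.proj (𝕜 := ℝ) i : E3 →L[ℝ] ℝ).differentiableAt.comp z
        (((hA.fderiv_right (m := ∞) (by simp)).differentiableAt (by simp)).clm_apply
          (differentiableAt_const (w i))))
  have d2 : ∀ (A : Ph → E3) (_ : ContDiffAt ℝ ∞ A z) (w : Ph) (i : Fin 3) (v : Ph),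
      fderiv ℝ (fun y => fderiv ℝ A y w i) z v = fderiv ℝ (fderiv ℝ A) z v w i :=
    fun A hA w i v => apply_fderiv_apply hA (EuclideanSpace.proj (𝕜 := ℝ) i : E3 →L[ℝ] ℝ) w v
  have e3 : fderiv ℝ (fun y => divP Aq y - divQ Ap y) z (X z) =
      ∑ i, fderiv ℝ (fderiv ℝ Aq) z (X z) (0, stdE i) i -
        ∑ i, fderiv ℝ (fderiv ℝ Ap) z (X z) (stdE i, 0) i := by
    simp only [divP, divQ]
    rw [((d1 Aq hq fun i => (0, stdE i)).fun_sub (d1 Ap hp fun i => (stdE i, 0))).fderiv]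
    simp [d2 Aq hq, d2 Ap hp]
  -- The force term gives c tr(H ∂_pA_p), and differentiating `X` in the other divergence gives c
  -- tr(∂_pA_p H); their difference vanishes.
  have tr := sum_apply_comp_comm (fderiv ℝ (∇ φ) z.1)
    (fderiv ℝ Ap z ∘L ContinuousLinearMap.inr ℝ E3 E3)
  simp only [ContinuousLinearMap.comp_apply, ContinuousLinearMap.inr_apply] at tr
  simp only [divP, divQ] at e3 ⊢
  simp only [e3, e1, e2, PiLp.add_apply, PiLp.sub_apply, PiLp.neg_apply, PiLp.smul_apply,
    smul_eq_mul, Finset.sum_add_distrib, Finset.sum_sub_distrib, Finset.sum_neg_distrib,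
    ← Finset.mul_sum, tr]
  ring

theorem MomentumVlasov.vlasov {m c : ℝ} (hm : 0 < m) {I : Set ℝ} (hI : IsOpen I) (hQ : IsOpen Q)
    {φ : ℝ → E3 → ℝ} (hφ : ∀ t ∈ I, IsFun Q (φ t)) {P : ℝ → PhForm}
    (hPI : ∀ t ∈ I, IsDecayForm Q (P t))
    (hP : ContDiffOn ℝ ∞ (fun y : ℝ × Ph => P y.1 y.2) (I ×ˢ phase Q))
    (h : MomentumVlasov Q m c I φ P) : Vlasov Q m c I φ fun t => density (P t) := by
  intro t ht z hz
  set B : PhForm := fun y => fderiv ℝ (fun x : ℝ × Ph => P x.1 x.2) (t, y) (1, 0) with hB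
  set X : Ph → Ph := fun y => ((1 / m) • y.2, -(c • ∇ (φ t) y.1)) with hX
  have hPd : ∀ y ∈ phase Q, HasDerivAt (fun s => P s y) (B y) t := fun y hy => by
    have := (hP.contDiffAt ((hI.prod (isOpen_phase hQ)).mem_nhds
      (show (t, y) ∈ I ×ˢ phase Q from ⟨ht, hy⟩))).differentiableAt (by simp)
    exact this.hasFDerivAt.comp_hasDerivAt t ((hasDerivAt_id t).prodMk (hasDerivAt_const t y))
  -- At the fixed time `t` the equations hold throughout a neighbourhood of `z`. By uniqueness of
  -- derivatives they identify the components of `B` as germs, so spatial divergences may be taken.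
  have hq : momQ B =ᶠ[nhds z] fun y => -(fderiv ℝ (momQ (P t)) y (X y)) +
      c • fderiv ℝ (∇ (φ t)) y.1 (momP (P t) y) := by
    filter_upwards [(isOpen_phase hQ).mem_nhds hz] with y hy
    have := (h t ht y hy).1
    rw [hamField_energy hm] at this
    exact (baseCLM.hasFDerivAt.comp_hasDerivAt t (hPd y hy)).unique this
  have hp : momP B =ᶠ[nhds z] fun y => -(fderiv ℝ (momP (P t)) y (X y)) -
      (1 / m) • momQ (P t) y := by
    filter_upwards [(isOpen_phase hQ).mem_nhds hz] with y hy
    have := (h t ht y hy).2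
    rw [hamField_energy hm] at this
    exact (fibreCLM.hasFDerivAt.comp_hasDerivAt t (hPd y hy)).unique this
  have hAq : ContDiffAt ℝ ∞ (momQ (P t)) z := by
    rw [momQ_eq]; exact baseCLM.contDiff.contDiffAt.comp z ((hPI t ht).contDiffAt hQ hz)
  have hAp : ContDiffAt ℝ ∞ (momP (P t)) z := by
    rw [momP_eq]; exact fibreCLM.contDiff.contDiffAt.comp z ((hPI t ht).contDiffAt hQ hz)
  have hdens : density (P t) = fun y => divP (momQ (P t)) y - divQ (momP (P t)) y :=
    funext fun y => density_eq _ y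
  have key := divP_sub_divQ_momentumVlasov ((hφ t ht).contDiffAt hQ (mem_phase.1 hz)) hAq hAp hX
  rw [← hdens] at key
  have hfd : DifferentiableAt ℝ (density (P t)) z :=
    (((hPI t ht).isDensity_density hQ).1.contDiffAt
      ((isOpen_phase hQ).mem_nhds hz)).differentiableAt (by simp)
  refine ⟨_, hasDerivAt_density hI hQ hP ht hz, ?_⟩
  have hBz : density B z = -fderiv ℝ (density (P t)) z (X z) := by
    rw [← key, density_eq]
    simp only [divP, divQ, hq.fderiv_eq, hp.fderiv_eq]
  rw [hBz, real_inner_comm, gradQ_inner hfd, real_inner_comm, gradP_inner hfd]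
  have : X z = ((1 / m) • z.2, 0) - c • (0, ∇ (φ t) z.1) := by simp [hX]
  rw [this, map_sub, map_smul, smul_eq_mul]
  ring

end PoissonVlasov

end

/-! ### Assembly of the six statements -/

theorem mainTheorem11 (Q : Set E3) (hQ : IsOpen Q) :
    -- the gauge group `F(Q)` acts on `T*Q` by symplectic fibre translations
    ((∀ z ∈ phase Q, fibreShift 0 z = z) ∧
      (∀ φ ψ, IsFun Q φ → IsFun Q ψ → ∀ z ∈ phase Q, fibreShift (φ + ψ) z = fibreShift φ (fibreShift ψ z)) ∧
      (∀ φ, IsFun Q φ →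
        MapsTo (fibreShift φ) (phase Q) (phase Q) ∧ ContDiffOn ℝ ∞ (fibreShift φ) (phase Q) ∧
        (∀ z ∈ phase Q, ∀ u v,
          symp (fderiv ℝ (fibreShift φ) z u) (fderiv ℝ (fibreShift φ) z v) = symp u v) ∧
        (∀ z ∈ phase Q, HasDerivAt (fun s : ℝ => fibreShift (s • φ) z) (ver (-dd φ) z) 0) ∧
        IsHamiltonianFor Q (ver (-dd φ)) (fun z => φ z.1))) ∧
    -- `ver ∘ d` embeds the gauge algebra as a commutative subalgebra of `𝔤`
    ((∀ φ, IsFun Q φ →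
        IsHamField Q (ver (dd φ)) ∧ IsHamiltonianFor Q (ver (dd φ)) (fun z => -φ z.1)) ∧
      (∀ φ ψ, IsFun Q φ → IsFun Q ψ →
        (∀ a b : ℝ, ∀ z ∈ phase Q,
          ver (dd (a • φ + b • ψ)) z = a • ver (dd φ) z + b • ver (dd ψ) z) ∧
        (∀ z ∈ phase Q, VectorField.lieBracket ℝ (ver (dd φ)) (ver (dd ψ)) z = 0) ∧
        (EqOn (ver (dd φ)) (ver (dd ψ)) (phase Q) ↔ EqOn (dd φ) (dd ψ) Q) ∧
        (IsPreconnected Q →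
          (EqOn (ver (dd φ)) (ver (dd ψ)) (phase Q) ↔ ∃ a : ℝ, ∀ q ∈ Q, φ q = ψ q + a))) ∧
      (∀ X : Ph → Ph, (IsHamField Q X ∧ ∀ z ∈ phase Q, (X z).1 = 0) ↔
        ∃ φ, IsFun Q φ ∧ EqOn X (ver (dd φ)) (phase Q))) ∧
    -- the two partial momentum maps, into the dual of `dF(Q)` and out of `𝔤*`
    ((∀ φ, IsFun Q φ →
        (∀ q ∈ Q, extDeriv (star1 (dd φ)) q = Laplacian.laplacian φ q • vol3) ∧
        (∀ ψ, IsTest Q ψ →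
          IntegrableOn (fun q => wedge12 (dd ψ) (star1 (dd φ)) q stdE) Q ∧
          pairQ Q (star1 (dd φ)) (dd ψ) = -integ3 Q ψ (extDeriv (star1 (dd φ))))) ∧
      (∀ P, IsDualForm Q P →
        (∀ q ∈ Q, Integrable fun p => divQ (momP P) (q, p)) ∧
        (∀ ψ, IsTest Q ψ →
          IntegrableOn (fun z => P z (ver (dd ψ) z)) (phase Q) ∧
          IntegrableOn (fun z => -ψ z.1 * divQ (momP P) z) (phase Q) ∧
          pairT Q P (ver (dd ψ)) = ∫ z in phase Q, -ψ z.1 * divQ (momP P) z)) ∧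
      (∀ f, IsDensity Q f →
        (∀ q ∈ Q, Integrable fun p => f (q, p)) ∧
        (∀ ψ, IsTest Q ψ → IntegrableOn (fun z => f z * -ψ z.1) (phase Q)))) ∧
    -- the combined momentum map on `*dF(Q) × 𝔤*`: formula, zero set, and the gauge action it generates
    (∀ φ P, IsFun Q φ → IsDualForm Q P →
      (∀ η : Form3, IsJP Q (star1 (dd φ)) P η ↔
        EqOn η (fun q => (Laplacian.laplacian φ q - ∫ p, divQ (momP P) (q, p)) • vol3) Q) ∧
      (IsJP Q (star1 (dd φ)) P 0 ↔
        ∀ q ∈ Q, Laplacian.laplacian φ q = ∫ p, divQ (momP P) (q, p)) ∧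
      (∀ c : ℝ, IsJP Q (star1 (dd φ)) (c • P) 0 ↔
        ∀ q ∈ Q, Laplacian.laplacian φ q = c * ∫ p, divQ (momP P) (q, p)) ∧
      IsDensity Q (density P) ∧
      (∀ c : ℝ, IsJP Q (star1 (dd φ)) (c • P) 0 ↔ PoissonEq Q c φ (density P)) ∧
      (∀ ψ χ, IsTest Q ψ → IsTest Q χ → ∀ X : Ph → Ph, ContDiff ℝ ∞ X → HasCompactSupport X →
        tsupport X ⊆ phase Q → IsHamField Q X →
        HasDerivAt
          (fun s : ℝ => pairQ Q (star1 (dd φ)) (dd χ) + pairT Q (gaugePull (s • ψ) P) X)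
          (lpBracket Q P X (ver (dd ψ))) 0)) ∧
    -- the analogous momentum map on `*dF(Q) × Den(T*Q)`
    (∀ φ f, IsFun Q φ → IsDensity Q f →
      (∀ c : ℝ,
        (∀ η : Form3, IsJDen Q (star1 (dd φ)) (fun z => c * f z) η ↔
          EqOn η (fun q => (-(Laplacian.laplacian φ q + c * ∫ p, f (q, p))) • vol3) Q) ∧
        (IsJDen Q (star1 (dd φ)) (fun z => c * f z) 0 ↔ PoissonEq Q c φ f)) ∧
      (∀ ψ χ, IsTest Q ψ → IsTest Q χ → ∀ k : Ph → ℝ, ContDiff ℝ ∞ k → HasCompactSupport k →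
        tsupport k ⊆ phase Q →
        HasDerivAt
          (fun s : ℝ => pairQ Q (star1 (dd φ)) (dd χ) + pairD Q (fun z => f (fibreShift (s • ψ) z)) k)
          (lpBracketDen Q f k (fun z => -ψ z.1)) 0)) ∧
    -- the zero values are the constraints on the momentum-Vlasov and on the Vlasov dynamics
    (∀ (m c : ℝ), 0 < m → ∀ (I : Set ℝ), IsOpen I → ∀ φ : ℝ → E3 → ℝ,
      (∀ t ∈ I, IsFun Q (φ t)) →
      (∀ P : ℝ → PhForm, (∀ t ∈ I, IsDualForm Q (P t)) →
        ((MomentumVlasov Q m c I φ P ∧ ∀ t ∈ I, PoissonEq Q c (φ t) (density (P t))) ↔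
          (MomentumVlasov Q m c I φ P ∧
            ∀ t ∈ I, IsJP Q (star1 (dd (φ t))) (c • P t) 0)) ∧
        (ContDiffOn ℝ ∞ (fun y : ℝ × Ph => P y.1 y.2) (I ×ˢ phase Q) →
          MomentumVlasov Q m c I φ P → (∀ t ∈ I, IsJP Q (star1 (dd (φ t))) (c • P t) 0) →
          Vlasov Q m c I φ (fun t => density (P t)) ∧
            ∀ t ∈ I, IsJDen Q (star1 (dd (φ t))) (fun z => c * density (P t) z) 0)) ∧
      (∀ f : ℝ → Ph → ℝ, (∀ t ∈ I, IsDensity Q (f t)) →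
        ((Vlasov Q m c I φ f ∧ ∀ t ∈ I, PoissonEq Q c (φ t) (f t)) ↔
          (Vlasov Q m c I φ f ∧
            ∀ t ∈ I, IsJDen Q (star1 (dd (φ t))) (fun z => c * f t z) 0)))) := by
  refine ⟨⟨fun z _ => fibreShift_zero z, fun φ ψ hφ hψ z hz => fibreShift_add
      (hφ.differentiableAt hQ (mem_phase.1 hz)) (hψ.differentiableAt hQ (mem_phase.1 hz)),
      fun φ hφ => ⟨fun z hz => mem_phase.2 (mem_phase.1 hz : z.1 ∈ Q),
        contDiffOn_fibreShift hφ hQ,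
        fun z hz => symp_fibreShift (hφ.contDiffAt hQ (mem_phase.1 hz)),
        fun z _ => hasDerivAt_fibreShift φ z, isHamiltonianFor_ver_neg hφ hQ⟩⟩,
    ⟨fun φ hφ => ⟨isHamField_ver hφ hQ, isHamiltonianFor_ver hφ hQ⟩,
      fun φ ψ hφ hψ => ⟨fun a b z hz => ver_linear (hφ.differentiableAt hQ (mem_phase.1 hz))
          (hψ.differentiableAt hQ (mem_phase.1 hz)) a b,
        fun z hz => lieBracket_ver (hφ.differentiableAt_gradient hQ (mem_phase.1 hz))
          (hψ.differentiableAt_gradient hQ (mem_phase.1 hz)),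
        eqOn_ver_iff φ ψ, fun hc => (eqOn_ver_iff φ ψ).trans (eqOn_dd_iff hφ hψ hQ hc)⟩,
      vertical_iff hQ⟩,
    ⟨fun φ hφ => ⟨fun q hq => extDeriv_star1_dd
          ((hφ.contDiffAt hQ hq).of_le (by simpa using ENat.LEInfty.out)),
        fun ψ hψ => ⟨hφ.integrableOn_wedge hQ hψ, hφ.pairQ_star_eq_integ3 hQ hψ⟩⟩,
      fun P hP => ⟨fun q hq => (hP.isDecayForm.isDensity_divQ hQ).integrable hq,
        fun ψ hψ => ⟨hP.isDecayForm.integrableOn_apply_ver hQ hψ,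
          (hP.isDecayForm.isDensity_divQ hQ).integrableOn_mul hQ hψ,
          hP.isDecayForm.pairT_ver hQ hψ⟩⟩,
      fun f hf => ⟨fun q hq => hf.integrable hq, fun ψ hψ => by
        simpa only [mul_comm] using hf.integrableOn_mul hQ hψ⟩⟩,
    fun φ P hφ hP => ⟨isJP_iff hQ hφ hP.isDecayForm, isJP_zero_iff hQ hφ hP.isDecayForm,
      isJP_smul_zero_iff hQ hφ hP.isDecayForm, hP.isDecayForm.isDensity_density hQ,
      isJP_smul_zero_iff_poissonEq hQ hφ hP.isDecayForm,
      fun ψ χ hψ _ X hX hXc hXQ _ =>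
        (hasDerivAt_pairT_gaugePull hψ hQ hP.1.continuousOn hX hXc hXQ).const_add _⟩,
    fun φ f hφ hf => ⟨fun c => ⟨isJDen_mul_iff hQ hφ hf c, isJDen_zero_iff_poissonEq hQ hφ hf c⟩,
      fun ψ χ hψ _ k hk hkc hkQ =>
        (hasDerivAt_pairD_fibreShift hψ hQ hf.1.continuousOn hk hkc hkQ).const_add _⟩,
    fun m c hm I hI φ hφ => ⟨fun P hP => ?_, fun f hf => and_congr_right fun _ =>
      forall₂_congr fun t ht => (isJDen_zero_iff_poissonEq hQ (hφ t ht) (hf t ht) c).symm⟩⟩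
  have hJ : ∀ t ∈ I, (IsJP Q (star1 (dd (φ t))) (c • P t) 0 ↔
      PoissonEq Q c (φ t) (density (P t))) := fun t ht =>
    isJP_smul_zero_iff_poissonEq hQ (hφ t ht) (hP t ht).isDecayForm c
  refine ⟨and_congr_right fun _ => forall₂_congr fun t ht => (hJ t ht).symm,
    fun hsm hMV hz => ⟨hMV.vlasov hm hI hQ hφ (fun t ht => (hP t ht).isDecayForm) hsm,
      fun t ht => ?_⟩⟩
  exact (isJDen_zero_iff_poissonEq hQ (hφ t ht) ((hP t ht).isDecayForm.isDensity_density hQ) c).2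
    ((hJ t ht).1 (hz t ht))
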